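/- A (left) brace is a set $B$ with two operations such that $(B,+)$ is an abelian group, $(B,\cdot)$ is a group, and $a\cdot(b+c)+a=a\cdot b+a\cdot c$ for all $a,b,c\in B$; $(B,+)$ is its additive group and $(B,\cdot)$ its multiplicative group. An isomorphism of braces is a bijection preserving both operations, and braces are counted up to isomorphism. Let $p$ and $q$ be primes with $q>p$, $q\ge 5$, $p\mid q-1$, $p\nmid q+1$ and $p^2\nmid q-1$ (so $p$ is odd), and let $\lambda$ be an element of order $p$ in $(\mathbf Z/(q))^*$. For $M\in\mathrm{GL}(2,q)$ of order $p$, let $(\mathbf Z/(q)\times\mathbf Z/(q))\rtimes_M\mathbf Z/(p^2)$ be the group of pairs $(v,z)$ with product $(v_1,z_1)\cdot(v_2,z_2)=(v_1+M^{z_1}v_2,\,z_1+z_2)$. There are exactly $(p^2+4p+9)/2$ braces with additive group $\mathbf Z/(p^2q)\times\mathbf Z/(q)$. Among them: a) exactly four have multiplicative group $\mathbf Z/(p^2q)\times\mathbf Z/(q)$; b) for each of the matrices $M=\begin{pmatrix}1&0\\0&\lambda\end{pmatrix}$, $M=\begin{pmatrix}\lambda&0\\0&\lambda\end{pmatrix}$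 and $M=\begin{pmatrix}\lambda&0\\0&\lambda^k\end{pmatrix}$ with $k\in(\mathbf Z/(p))^*$, $k\ne 1,-1,2,(p+1)/2$ (where $k$ and $k^{-1}$ give isomorphic groups), exactly $p$ have multiplicative group $(\mathbf Z/(q)\times\mathbf Z/(q))\rtimes_M\mathbf Z/(p^2)$; c) if $p\neq 3$, for $M=\begin{pmatrix}\lambda&0\\0&\lambda^{-1}\end{pmatrix}$ exactly $(p+1)/2$ have multiplicative group $(\mathbf Z/(q)\times\mathbf Z/(q))\rtimes_M\mathbf Z/(p^2)$; d) if $p\neq 3$, for $M=\begin{pmatrix}\lambda&0\\0&\lambda^{(p+1)/2}\end{pmatrix}$ exactly $2p$ have multiplicative group $(\mathbf Z/(q)\times\mathbf Z/(q))\rtimes_M\mathbf Z/(p^2)$; e) if $p=3$, the matrices in c) and d) coincide, and for this $M$ exactly $5$ have multiplicative group $(\mathbf Z/(q)\times\mathbf Z/(q))\rtimes_M\mathbf Z/(p^2)$. -/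

import Mathlib

/-- A (left) brace: an abelian group `(B, +)` and a group `(B, ·)` on the same set with
`a · (b + c) + a = a · b + a · c`. -/
class LeftBrace (B : Type*) extends AddCommGroup B, Group B where
  brace_compat : ∀ a b c : B, a * (b + c) + a = a * b + a * c

/-- A brace together with its underlying set. -/
structure BundledBrace where
  carrier : Type
  [str : LeftBrace carrier]

instance : CoeSort BundledBrace Type := ⟨BundledBrace.carrier⟩

instance (B : BundledBrace) : LeftBrace B := B.str

/-- Isomorphism of braces: existence of a bijection preserving `+` and `·`. (In Mathlib `B ≃+* C`
only asks for an addition and a multiplication on both sides, and no ring axioms.) -/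
instance braceSetoid : Setoid BundledBrace where
  r B C := Nonempty (B ≃+* C)
  iseqv :=
    { refl := fun B => ⟨RingEquiv.refl B⟩
      symm := fun ⟨e⟩ => ⟨e.symm⟩
      trans := fun ⟨e⟩ ⟨f⟩ => ⟨e.trans f⟩ }

/-- Isomorphism classes of braces. -/
abbrev BraceClass : Type 1 := Quotient braceSetoid

/-- Isomorphism classes of braces with additive group isomorphic to `A`. -/
def bracesWithAdd (A : Type) [AddCommGroup A] : Set BraceClass :=
  {c | ∃ B : BundledBrace, ⟦B⟧ = c ∧ Nonempty (B ≃+ A)}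

/-- Isomorphism classes of braces with additive group isomorphic to `A` and multiplicative group
isomorphic to `G`. -/
def bracesWithAddMul (A G : Type) [AddCommGroup A] [Group G] : Set BraceClass :=
  {c | ∃ B : BundledBrace, ⟦B⟧ = c ∧ Nonempty (B ≃+ A) ∧ Nonempty (B ≃* G)}

/-- `GL(2, R)` acting on `(R × R, +)`, written multiplicatively, by `v ↦ M v`. -/
def glAction (R : Type) [CommRing R] :
    GL (Fin 2) R →* MulAut (Multiplicative (Fin 2 → R)) where
  toFun M :=
    { toFun := fun v => Multiplicative.ofAdd (M.val.mulVec v.toAdd)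
      invFun := fun v => Multiplicative.ofAdd (M⁻¹.val.mulVec v.toAdd)
      left_inv := fun v => by
        simp only [toAdd_ofAdd, Matrix.mulVec_mulVec, ← Units.val_mul, inv_mul_cancel,
          Units.val_one, Matrix.one_mulVec, ofAdd_toAdd]
      right_inv := fun v => by
        simp only [toAdd_ofAdd, Matrix.mulVec_mulVec, ← Units.val_mul, mul_inv_cancel,
          Units.val_one, Matrix.one_mulVec, ofAdd_toAdd]
      map_mul' := fun v w => by
        simp only [toAdd_mul, Matrix.mulVec_add, ofAdd_add] }
  map_one' := by
    ext v : 1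
    change Multiplicative.ofAdd ((1 : GL (Fin 2) R).val.mulVec v.toAdd) = v
    simp only [Units.val_one, Matrix.one_mulVec, ofAdd_toAdd]
  map_mul' M N := by
    ext v : 1
    change Multiplicative.ofAdd ((M * N).val.mulVec v.toAdd) =
      Multiplicative.ofAdd (M.val.mulVec (N.val.mulVec v.toAdd))
    simp only [Units.val_mul, Matrix.mulVec_mulVec]

/-- For `g ^ n = 1`, the morphism `z ↦ g ^ z` from `(ZMod n, +)`. -/
def zmodPow {H : Type} [Group H] (n : ℕ) [NeZero n] (g : H) (hg : g ^ n = 1) :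
    Multiplicative (ZMod n) →* H where
  toFun z := g ^ z.toAdd.val
  map_one' := by simp
  map_mul' x y := by
    rw [toAdd_mul, ZMod.val_add, ← pow_add]
    exact (pow_eq_pow_mod _ hg).symm

/-- The diagonal matrix with invertible entries `a`, `b`. -/
def diagGL {R : Type} [CommRing R] (a b : Rˣ) : GL (Fin 2) R where
  val := Matrix.diagonal ![(a : R), (b : R)]
  inv := Matrix.diagonal ![((a⁻¹ : Rˣ) : R), ((b⁻¹ : Rˣ) : R)]
  val_inv := by
    ext i j; fin_cases i <;> fin_cases j <;> simp
  inv_val := by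
    ext i j; fin_cases i <;> fin_cases j <;> simp

theorem diagGL_pow {R : Type} [CommRing R] (a b : Rˣ) (n : ℕ) :
    diagGL a b ^ n = diagGL (a ^ n) (b ^ n) := by
  apply Units.ext
  rw [Units.val_pow_eq_pow_val]
  simp only [diagGL, Matrix.diagonal_pow]
  congr 1
  ext i
  fin_cases i <;> simp

/-- The matrix `diag(l ^ i, l ^ j)`. -/
def lambdaMatrix {R : Type} [CommRing R] (l : Rˣ) (i j : ℤ) : GL (Fin 2) R :=
  diagGL (l ^ i) (l ^ j)

theorem lambdaMatrix_pow {R : Type} [CommRing R] {p : ℕ} {l : Rˣ} (hl : orderOf l = p)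
    (i j : ℤ) : lambdaMatrix l i j ^ (p ^ 2) = 1 := by
  have h : l ^ p = 1 := hl ▸ pow_orderOf_eq_one l
  have h' : ∀ k : ℤ, (l ^ k) ^ (p ^ 2) = 1 := fun k => by
    rw [← zpow_natCast, zpow_comm, zpow_natCast, pow_two, pow_mul, h, one_pow, one_zpow]
  rw [lambdaMatrix, diagGL_pow, h', h']
  apply Units.ext
  ext i j
  fin_cases i <;> fin_cases j <;> simp [diagGL]

/-- The group `(ZMod q × ZMod q) ⋊_M ZMod (p ^ 2)` for `M = diag(l ^ i, l ^ j)` with `l` of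
order `p`; its product is `(v₁, z₁) · (v₂, z₂) = (v₁ + M ^ z₁ v₂, z₁ + z₂)`. -/
abbrev SemidirectM (p q : ℕ) [NeZero p] (l : (ZMod q)ˣ) (hl : orderOf l = p) (i j : ℤ) : Type :=
  Multiplicative (Fin 2 → ZMod q)
    ⋊[(glAction (ZMod q)).comp (zmodPow (p ^ 2) (lambdaMatrix l i j) (lambdaMatrix_pow hl i j))]
      Multiplicative (ZMod (p ^ 2))

/-! Write the additive group as `V × Z` with `V = (ℤ/q)²` and `Z = ℤ/p²`. The maps `λ_a : b ↦ a * b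
- a` are additive and multiplicative in `a`. Since `p ≠ q` they preserve `V` and `Z`, which are
therefore subbraces of orders `q²` and `p²`, with abelian multiplicative groups. On `Z` this gives
`z + w + pτzw`. As `p < q`, the subbrace `V` acts trivially on `Z`. It acts on itself by `1 + β(v)`
with `β` symmetric, bilinear and nilpotent, hence of zero square, so all triple products vanish
(`exists_bilinear_and_action`).

There remains an action of `Z` on `V` by brace automorphisms, generated by one matrix of `p`-power
order (`exists_generator`). The arithmetic hypotheses give `GL(2, q)` a Sylow `p`-subgroup of order
`p²`, namely the diagonal matrices with entries in `⟨l⟩`, so the matrix is conjugate to `diag(l^i,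
l^j)` (`exists_conj_diagGL`). If `β ≠ 0`, a suitable eigenvector `a` and `β(a)a` form an eigenbasis
with eigenvalues `d` and `d²`, which forces `i = 2j` (`exists_eigenbasis`). Every brace is thus a
model with parameters `ε`, `δ`, `i`, `j`, where `ε` can be normalised to `0` or `1` and `δ` is `0`
or `1`.

Isomorphisms of models scale `(i, j)` by a unit, which must be `1` if `ε = 1`, and may swap `i` and
`j` if `δ = 0` (`relation_of_equiv`). The invariants are pairs up to scaling and swap, unordered
pairs, the condition `j = 0`, and elements `j`. This gives `(p + 5)/2 + p(p + 1)/2 + 2 + p` classes.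

The terms with `ε` and `δ` are coboundaries for the multiplicative group, because `2` is invertible
(`nonempty_mulEquiv`). Hence that group is determined by the class of `(i, j)` up to scaling and
swap, and conversely determines it (`relation_of_mulEquiv`). The remaining numbers are cardinalities
of the fibres of invariants over these classes. -/

/-- Reduction `ℤ/(p²) → ℤ/(p)`. -/
def modP (p : ℕ) : ZMod (p ^ 2) →+* ZMod p := ZMod.castHom (dvd_pow_self p two_ne_zero) _

theorem natCast_mul_self_zmod_sq (p : ℕ) : (p : ZMod (p ^ 2)) * p = 0 := by
  rw [← Nat.cast_mul, ← pow_two, ZMod.natCast_self]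

theorem modP_natCast_self (p : ℕ) : modP p (p : ZMod (p ^ 2)) = 0 := by
  rw [map_natCast, ZMod.natCast_self]

theorem modP_surjective (p : ℕ) : Function.Surjective (modP p) :=
  ZMod.castHom_surjective _

theorem natCast_mul_eq_zero_iff {p : ℕ} [NeZero p] (z : ZMod (p ^ 2)) :
    (p : ZMod (p ^ 2)) * z = 0 ↔ modP p z = 0 := by
  obtain ⟨n, rfl⟩ := ZMod.natCast_zmod_surjective z
  rw [map_natCast, ← Nat.cast_mul, ZMod.natCast_eq_zero_iff, ZMod.natCast_eq_zero_iff, pow_two,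
    Nat.mul_dvd_mul_iff_left (NeZero.pos p)]

theorem isUnit_iff_modP_ne_zero {p : ℕ} [Fact p.Prime] (z : ZMod (p ^ 2)) :
    IsUnit z ↔ modP p z ≠ 0 := by
  obtain ⟨n, rfl⟩ := ZMod.natCast_zmod_surjective z
  rw [map_natCast, ZMod.isUnit_iff_coprime, Ne, ZMod.natCast_eq_zero_iff,
    Nat.coprime_pow_right_iff two_pos, Nat.coprime_comm,
    (Fact.out : p.Prime).coprime_iff_not_dvd]

/-! ### The model braces. -/

/-- The parameters of a brace on `(ℤ/(q))² × ℤ/(p²)` in normal form. -/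
structure BraceParam (p q : ℕ) where
  /-- the character giving the eigenvalues -/
  ψ : AddChar (ZMod p) (ZMod q)
  /-- the coefficient of the product on `ℤ/(p²)` -/
  ε : ZMod (p ^ 2)
  /-- the coefficient of the product on `(ℤ/(q))²` -/
  δ : ZMod q
  /-- the exponent of the first eigenvalue -/
  i : ZMod p
  /-- the exponent of the second eigenvalue -/
  j : ZMod p
  compat : δ = 0 ∨ i = 2 * j

namespace BraceParam

variable {p q : ℕ}

/-- The set `(ℤ/(q))² × ℤ/(p²)`, on which the brace with parameters `s` lives. -/
@[ext]
structure Carrier (s : BraceParam p q) where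
  /-- the first coordinate in `(ℤ/(q))²` -/
  x : ZMod q
  /-- the second coordinate in `(ℤ/(q))²` -/
  y : ZMod q
  /-- the coordinate in `ℤ/(p²)` -/
  z : ZMod (p ^ 2)

/-- The carrier as a product. -/
def Carrier.equivProd (s : BraceParam p q) : s.Carrier ≃ (Fin 2 → ZMod q) × ZMod (p ^ 2) where
  toFun a := (![a.x, a.y], a.z)
  invFun a := ⟨a.1 0, a.1 1, a.2⟩
  left_inv a := rfl
  right_inv a := by
    refine Prod.ext (funext fun k => ?_) rfl
    fin_cases k <;> rfl

instance (s : BraceParam p q) : AddCommGroup s.Carrier := (Carrier.equivProd s).addCommGroup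

variable (s : BraceParam p q)

/-- The action of `z` on the first coordinate. -/
def χ (z : ZMod (p ^ 2)) : ZMod q := s.ψ (s.i * modP p z)

/-- The action of `z` on the second coordinate. -/
def η (z : ZMod (p ^ 2)) : ZMod q := s.ψ (s.j * modP p z)

theorem χ_add (z w : ZMod (p ^ 2)) : s.χ (z + w) = s.χ z * s.χ w := by
  simp only [χ, map_add, mul_add, AddChar.map_add_eq_mul]

theorem η_add (z w : ZMod (p ^ 2)) : s.η (z + w) = s.η z * s.η w := by
  simp only [η, map_add, mul_add, AddChar.map_add_eq_mul]

theorem χ_p_mul (z : ZMod (p ^ 2)) : s.χ ((p : ZMod (p ^ 2)) * z) = 1 := by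
  simp [χ]

theorem η_p_mul (z : ZMod (p ^ 2)) : s.η ((p : ZMod (p ^ 2)) * z) = 1 := by
  simp [η]

theorem χ_zero : s.χ 0 = 1 := by simp [χ]

theorem η_zero : s.η 0 = 1 := by simp [η]

/-- This relation says that the action of `z` respects the product `δyy'` on `(ℤ/q)²`; associativity
depends on it. -/
theorem δ_mul_χ (z : ZMod (p ^ 2)) : s.δ * s.χ z = s.δ * s.η z ^ 2 := by
  rcases s.compat with h | h
  · simp [h]
  · rw [χ, h, two_mul, add_mul, AddChar.map_add_eq_mul, sq (s.η z)]
    rfl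

/-- On each primary part this is the circle operation `a + b + ab` of a commutative nilpotent ring,
with ring products `(δyy', 0)` and `pεzz'`; in addition `z` acts diagonally on the `q`-part. -/
instance : Mul s.Carrier where
  mul a b := ⟨a.x + s.χ a.z * b.x + s.δ * a.y * (s.η a.z * b.y),
    a.y + s.η a.z * b.y, a.z + b.z + p * (s.ε * a.z * b.z)⟩

instance : One s.Carrier where one := ⟨0, 0, 0⟩

instance : Inv s.Carrier where
  inv a := ⟨-s.χ (-a.z) * a.x + s.δ * (s.η (-a.z) * a.y) ^ 2, -s.η (-a.z) * a.y,
    -a.z + p * (s.ε * a.z ^ 2)⟩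

variable {s}

theorem mul_x (a b : s.Carrier) :
    (a * b).x = a.x + s.χ a.z * b.x + s.δ * a.y * (s.η a.z * b.y) := rfl

theorem mul_y (a b : s.Carrier) : (a * b).y = a.y + s.η a.z * b.y := rfl

theorem mul_z (a b : s.Carrier) : (a * b).z = a.z + b.z + p * (s.ε * a.z * b.z) := rfl

theorem inv_x (a : s.Carrier) :
    (a⁻¹).x = -s.χ (-a.z) * a.x + s.δ * (s.η (-a.z) * a.y) ^ 2 := rfl

theorem inv_y (a : s.Carrier) : (a⁻¹).y = -s.η (-a.z) * a.y := rfl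

theorem inv_z (a : s.Carrier) : (a⁻¹).z = -a.z + p * (s.ε * a.z ^ 2) := rfl

theorem one_x : (1 : s.Carrier).x = 0 := rfl

theorem one_y : (1 : s.Carrier).y = 0 := rfl

theorem one_z : (1 : s.Carrier).z = 0 := rfl

theorem add_x (a b : s.Carrier) : (a + b).x = a.x + b.x := rfl

theorem add_y (a b : s.Carrier) : (a + b).y = a.y + b.y := rfl

theorem add_z (a b : s.Carrier) : (a + b).z = a.z + b.z := rfl

instance : Group s.Carrier :=
  Group.ofLeftAxioms
    (fun a b c => by
      refine Carrier.ext ?_ ?_ ?_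
      · simp only [mul_x, mul_y, mul_z, χ_add, η_add, χ_p_mul, η_p_mul]
        linear_combination
          (-b.y * s.η b.z * c.y) * s.δ_mul_χ a.z
      · simp only [mul_y, mul_z, η_add, η_p_mul]
        ring
      · simp only [mul_z]
        ring)
    (fun a => by
      refine Carrier.ext ?_ ?_ ?_
      · simp only [mul_x, one_x, one_y, one_z, χ_zero, η_zero]
        ring
      · simp only [mul_y, one_y, one_z, η_zero]
        ring
      · simp only [mul_z, one_z]
        ring)
    (fun a => by
      refine Carrier.ext ?_ ?_ ?_
      · simp only [mul_x, inv_x, inv_y, inv_z, χ_add, χ_p_mul, η_add,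
          η_p_mul, one_x]
        ring
      · simp only [mul_y, inv_y, inv_z, η_add, η_p_mul, one_y]
        ring
      · simp only [mul_z, inv_z, one_z]
        linear_combination (s.ε ^ 2 * a.z ^ 3) * natCast_mul_self_zmod_sq p)

instance : LeftBrace s.Carrier where
  brace_compat a b c := by
    refine Carrier.ext ?_ ?_ ?_
    · simp only [mul_x, add_x, add_y]
      ring
    · simp only [mul_y, add_y]
      ring
    · simp only [mul_z, add_z]
      ring

/-- The brace with parameters `s`. -/
def toBrace (s : BraceParam p q) : BundledBrace := ⟨s.Carrier⟩

/-- The multiplicative group depends only on `ψ`, `i` and `j`. -/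
theorem nonempty_mulEquiv (hp : p ≠ 2) (hq : q ≠ 2) [Fact p.Prime] [Fact q.Prime]
    (s t : BraceParam p q) (hψ : s.ψ = t.ψ) (hi : s.i = t.i) (hj : s.j = t.j) (ht : t.ε = 0)
    (ht' : t.δ = 0) : Nonempty (s.Carrier ≃* t.Carrier) := by
  obtain ⟨h, hh⟩ : ∃ h : ZMod (p ^ 2), 2 * h = 1 := by
    have : IsUnit (2 : ZMod (p ^ 2)) := by
      rw [isUnit_iff_modP_ne_zero, map_ofNat]
      exact Ring.two_ne_zero (by rwa [ZMod.ringChar_zmod_n])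
    obtain ⟨u, hu⟩ := this
    exact ⟨↑u⁻¹, by rw [← hu, Units.mul_inv]⟩
  have h2 : (2 : ZMod q) ≠ 0 := Ring.two_ne_zero (by rwa [ZMod.ringChar_zmod_n])
  obtain ⟨k, hk⟩ : ∃ k : ZMod q, 2 * k = 1 := ⟨2⁻¹, mul_inv_cancel₀ h2⟩
  have hχ : ∀ z, t.χ z = s.χ z := fun z => by rw [χ, χ, hψ, hi]
  have hη : ∀ z, t.η z = s.η z := fun z => by rw [η, η, hψ, hj]
  have hpp := natCast_mul_self_zmod_sq p
  -- The symmetric cocycles `δyy'` and `pεzz'` are the coboundaries of the quadratic maps `δy²/2`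
  -- and `pεz²/2`; here `k` and `h` are the two halves. The correction in `z` is a multiple of `p`,
  -- so it does not affect the action and is inverted by a change of sign.
  refine ⟨⟨⟨fun a => ⟨a.x - s.δ * k * a.y ^ 2, a.y, a.z - p * (s.ε * h * a.z ^ 2)⟩,
    fun a => ⟨a.x + s.δ * k * a.y ^ 2, a.y, a.z + p * (s.ε * h * a.z ^ 2)⟩, ?_, ?_⟩,
    ?_⟩⟩
  · intro a
    refine Carrier.ext ?_ ?_ ?_
    · simp
    · simp
    · dsimp only
      linear_combination (-2 * a.z ^ 3 * s.ε ^ 2 * h ^ 2 + p * s.ε ^ 3 * h ^ 3 * a.z ^ 4) * hpp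
  · intro a
    refine Carrier.ext ?_ ?_ ?_
    · simp
    · simp
    · dsimp only
      linear_combination (-2 * a.z ^ 3 * s.ε ^ 2 * h ^ 2 - p * s.ε ^ 3 * h ^ 3 * a.z ^ 4) * hpp
  · intro a b
    refine Carrier.ext ?_ ?_ ?_
    · simp only [mul_x, mul_y, hχ, hη, ht']
      have e1 : s.χ (a.z - p * (s.ε * h * a.z ^ 2)) = s.χ a.z := by
        rw [sub_eq_add_neg, ← mul_neg, χ_add, χ_p_mul, mul_one]
      rw [e1]
      linear_combination (k * b.y ^ 2) * s.δ_mul_χ a.z -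
        (s.δ * a.y * s.η a.z * b.y) * hk
    · simp only [mul_y, hη]
      have e1 : s.η (a.z - p * (s.ε * h * a.z ^ 2)) = s.η a.z := by
        rw [sub_eq_add_neg, ← mul_neg, η_add, η_p_mul, mul_one]
      rw [e1]
    · simp only [mul_z, ht]
      linear_combination (-(p : ZMod (p ^ 2)) * s.ε * a.z * b.z) * hh -
        (s.ε ^ 2 * h * a.z * b.z * (2 * (a.z + b.z) + p * s.ε * a.z * b.z)) * hpp

end BraceParam

/-! ### Isomorphisms between models, as braces and as groups. -/

namespace BraceParam

variable {p q : ℕ}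

/-- The isomorphism is multiplication by `u` on `ℤ/(p²)` and the identity on `(ℤ/(q))²`. -/
theorem ringEquiv_of_unit (s t : BraceParam p q) (u : (ZMod (p ^ 2))ˣ) (hψ : s.ψ = t.ψ)
    (hε : s.ε = t.ε * (u : ZMod (p ^ 2))) (hδ : s.δ = t.δ) (hi : s.i = modP p (u : ZMod (p ^ 2)) * t.i)
    (hj : s.j = modP p (u : ZMod (p ^ 2)) * t.j) : s.toBrace ≈ t.toBrace := by
  have hχ : ∀ z, t.χ ((u : ZMod (p ^ 2)) * z) = s.χ z := fun z => by
    rw [χ, χ, hψ, hi, map_mul (modP p)]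
    congr 1
    ring
  have hη : ∀ z, t.η ((u : ZMod (p ^ 2)) * z) = s.η z := fun z => by
    rw [η, η, hψ, hj, map_mul (modP p)]
    congr 1
    ring
  refine ⟨(⟨⟨fun a => ⟨a.x, a.y, u * a.z⟩, fun a => ⟨a.x, a.y, ↑u⁻¹ * a.z⟩, fun a => ?_,
    fun a => ?_⟩, fun a b => ?_, fun a b => ?_⟩ : s.Carrier ≃+* t.Carrier)⟩
  · ext <;> simp
  · ext <;> simp
  · ext
    · simp only [mul_x, hχ, hη, hδ]
    · simp only [mul_y, hη]
    · simp only [mul_z, hε]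
      ring
  · ext
    · simp only [add_x]
    · simp only [add_y]
    · simp only [add_z, mul_add]

theorem ringEquiv_of_swap (s t : BraceParam p q) (hψ : s.ψ = t.ψ)
    (hε : s.ε = t.ε) (hδ : s.δ = 0) (hδ' : t.δ = 0) (hi : s.i = t.j)
    (hj : s.j = t.i) : s.toBrace ≈ t.toBrace := by
  have hχ : ∀ z, t.χ z = s.η z := fun z => by rw [χ, η, hψ, hj]
  have hη : ∀ z, t.η z = s.χ z := fun z => by rw [χ, η, hψ, hi]
  refine ⟨(⟨⟨fun a => ⟨a.y, a.x, a.z⟩, fun a => ⟨a.y, a.x, a.z⟩, fun a => rfl,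
    fun a => rfl⟩, fun a b => ?_, fun a b => ?_⟩ : s.Carrier ≃+* t.Carrier)⟩
  · ext
    · simp only [mul_x, mul_y, hχ, hδ', zero_mul, add_zero]
    · simp only [mul_x, mul_y, hη, hδ, zero_mul, add_zero]
    · simp only [mul_z, hε]
  · rfl

theorem pow_z_of_ε_eq_zero {s : BraceParam p q} (hε : s.ε = 0) (a : s.Carrier) (n : ℕ) :
    (a ^ n).z = n * a.z := by
  induction n with
  | zero => simp [one_z]
  | succ n ih =>
    rw [pow_succ a n, mul_z, ih, hε]
    push_cast
    ring

theorem addMonoidHom_eq_zero_of_coprime {m n : ℕ} [NeZero m] (h : m.Coprime n)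
    (f : ZMod m →+ ZMod n) (a : ZMod m) : f a = 0 := by
  have h1 : (m : ZMod n) * f a = 0 := by
    rw [← nsmul_eq_mul, ← map_nsmul, nsmul_eq_mul, ZMod.natCast_self, zero_mul, map_zero]
  exact ((ZMod.isUnit_iff_coprime m n).mpr h).mul_right_eq_zero.mp h1

theorem addMonoidHom_apply_eq_mul {n : ℕ} (f : ZMod n →+ ZMod n) (a : ZMod n) :
    f a = f 1 * a := by
  have h := ZMod.map_smul f a 1
  rwa [smul_eq_mul, mul_one, smul_eq_mul, mul_comm] at h

theorem det_ne_zero_of_injective {F : Type*} [Field F] {a b c d : F}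
    (h : ∀ x y, a * x + b * y = 0 → c * x + d * y = 0 → x = 0 ∧ y = 0) : a * d - b * c ≠ 0 := by
  intro h0
  -- If the determinant vanishes, `(d, -c)` and `(b, -a)` lie in the kernel, so all entries are zero
  -- and `(1, 1)` is in the kernel as well.
  obtain ⟨hd, hc⟩ := h d (-c) (by linear_combination h0) (by ring)
  obtain ⟨hb, ha⟩ := h b (-a) (by ring) (by linear_combination -h0)
  have := (h 1 1 (by simp_all) (by simp_all)).1
  exact one_ne_zero this

/-- One of the products `ad`, `bc` is nonzero, and cancelling its two factors matches the
eigenvalues in one order or the other. -/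
theorem eq_or_swap_of_intertwine {F : Type*} [Field F] {a b c d x y x' y' : F}
    (h : a * d - b * c ≠ 0) (ha : a * x = x' * a) (hb : b * y = x' * b) (hc : c * x = y' * c)
    (hd : d * y = y' * d) : (x = x' ∧ y = y') ∨ (x = y' ∧ y = x') := by
  by_cases had : a * d = 0
  · have hbc : b * c ≠ 0 := fun h' => h (by rw [had, h', sub_zero])
    exact .inr ⟨mul_left_cancel₀ (right_ne_zero_of_mul hbc) (hc.trans (mul_comm _ _)),
      mul_left_cancel₀ (left_ne_zero_of_mul hbc) (hb.trans (mul_comm _ _))⟩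
  · exact .inl ⟨mul_left_cancel₀ (left_ne_zero_of_mul had) (ha.trans (mul_comm _ _)),
      mul_left_cancel₀ (right_ne_zero_of_mul had) (hd.trans (mul_comm _ _))⟩

variable [Fact p.Prime] [Fact q.Prime]

/-- There are no nonzero additive maps between the `p`-part and the `q`-part, so the isomorphism is
a matrix together with a scalar. -/
theorem exists_coeff_of_addEquiv (hpq : p ≠ q) {s t : BraceParam p q}
    (f : s.Carrier ≃+ t.Carrier) :
    ∃ (a b c d : ZMod q) (u : ZMod (p ^ 2)), a * d - b * c ≠ 0 ∧ modP p u ≠ 0 ∧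
      ∀ x y z, f ⟨x, y, z⟩ = ⟨a * x + b * y, c * x + d * y, u * z⟩ := by
  have hco : p.Coprime q := (Nat.coprime_primes Fact.out Fact.out).mpr hpq
  let fx : ZMod q →+ t.Carrier :=
    f.toAddMonoidHom.comp ⟨⟨fun x => ⟨x, 0, 0⟩, rfl⟩, fun x y => by ext <;> simp [add_x, add_y, add_z]⟩
  let fy : ZMod q →+ t.Carrier :=
    f.toAddMonoidHom.comp ⟨⟨fun y => ⟨0, y, 0⟩, rfl⟩, fun x y => by ext <;> simp [add_x, add_y, add_z]⟩
  let fz : ZMod (p ^ 2) →+ t.Carrier :=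
    f.toAddMonoidHom.comp ⟨⟨fun z => ⟨0, 0, z⟩, rfl⟩, fun x y => by ext <;> simp [add_x, add_y, add_z]⟩
  let gx : t.Carrier →+ ZMod q := ⟨⟨Carrier.x, rfl⟩, fun _ _ => rfl⟩
  let gy : t.Carrier →+ ZMod q := ⟨⟨Carrier.y, rfl⟩, fun _ _ => rfl⟩
  let gz : t.Carrier →+ ZMod (p ^ 2) := ⟨⟨Carrier.z, rfl⟩, fun _ _ => rfl⟩
  have key : ∀ x y z, f ⟨x, y, z⟩ = ⟨(fx 1).x * x + (fy 1).x * y,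
      (fx 1).y * x + (fy 1).y * y, (fz 1).z * z⟩ := by
    intro x y z
    have e : (⟨x, y, z⟩ : s.Carrier) = ⟨x, 0, 0⟩ + ⟨0, y, 0⟩ + ⟨0, 0, z⟩ := by
      ext <;> simp [add_x, add_y, add_z]
    have e' : f ⟨x, y, z⟩ = fx x + fy y + fz z := by
      rw [e, map_add, map_add]; rfl
    have hqp := hco.symm.pow_right 2
    have hpq' := hco.pow_left 2
    rw [e']
    ext
    · rw [add_x, add_x]
      have h1 : (fx x).x = (fx 1).x * x := addMonoidHom_apply_eq_mul (gx.comp fx) x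
      have h2 : (fy y).x = (fy 1).x * y := addMonoidHom_apply_eq_mul (gx.comp fy) y
      have h3 : (fz z).x = 0 := addMonoidHom_eq_zero_of_coprime hpq' (gx.comp fz) z
      rw [h1, h2, h3, add_zero]
    · rw [add_y, add_y]
      have h1 : (fx x).y = (fx 1).y * x := addMonoidHom_apply_eq_mul (gy.comp fx) x
      have h2 : (fy y).y = (fy 1).y * y := addMonoidHom_apply_eq_mul (gy.comp fy) y
      have h3 : (fz z).y = 0 := addMonoidHom_eq_zero_of_coprime hpq' (gy.comp fz) z
      rw [h1, h2, h3, add_zero]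
    · rw [add_z, add_z]
      have h1 : (fx x).z = 0 := addMonoidHom_eq_zero_of_coprime hqp (gz.comp fx) x
      have h2 : (fy y).z = 0 := addMonoidHom_eq_zero_of_coprime hqp (gz.comp fy) y
      have h3 : (fz z).z = (fz 1).z * z := addMonoidHom_apply_eq_mul (gz.comp fz) z
      rw [h1, h2, h3, zero_add, zero_add]
  have inj : ∀ x y z, f ⟨x, y, z⟩ = ⟨0, 0, 0⟩ → x = 0 ∧ y = 0 ∧ z = 0 := by
    intro x y z h
    have h' : f ⟨x, y, z⟩ = 0 := h
    rw [EmbeddingLike.map_eq_zero_iff] at h'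
    exact ⟨congrArg Carrier.x h', congrArg Carrier.y h', congrArg Carrier.z h'⟩
  refine ⟨_, _, _, _, _, det_ne_zero_of_injective fun x y h1 h2 => ?_, fun hu => ?_, key⟩
  · obtain ⟨hx, hy, -⟩ := inj x y 0 (by rw [key, h1, h2, mul_zero])
    exact ⟨hx, hy⟩
  · obtain ⟨-, -, h⟩ := inj 0 0 p (by
      rw [key, mul_comm _ (p : ZMod (p ^ 2)), (natCast_mul_eq_zero_iff _).mpr hu]; simp)
    have h1 := (natCast_mul_eq_zero_iff (1 : ZMod (p ^ 2))).mp (by rw [mul_one, h])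
    rw [map_one] at h1
    exact one_ne_zero h1

/-- The parameters are read off from products of basis elements: `z·z` gives `ε`, `y·y` and `x·x`
give `δ`, and `z·x`, `z·y` say that the matrix of the isomorphism intertwines the two actions. Only
`pε` is visible, because `ε` enters the product multiplied by `p`. -/
theorem relation_of_equiv (hpq : p ≠ q) {s t : BraceParam p q} (hψ : s.ψ = t.ψ)
    (hinj : Function.Injective s.ψ) (h : s.toBrace ≈ t.toBrace) :
    ∃ u : ZMod (p ^ 2), modP p u ≠ 0 ∧ p * s.ε = p * (t.ε * u) ∧ (s.δ = 0 ↔ t.δ = 0) ∧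
      ((s.i = modP p u * t.i ∧ s.j = modP p u * t.j) ∨
        (s.i = modP p u * t.j ∧ s.j = modP p u * t.i)) ∧
      (s.δ ≠ 0 → s.j = modP p u * t.j) := by
  obtain ⟨f : s.Carrier ≃+* t.Carrier⟩ := h
  obtain ⟨a, b, c, d, u, hdet, hu, key⟩ := exists_coeff_of_addEquiv hpq f.toAddEquiv
  replace key : ∀ x y z, f ⟨x, y, z⟩ = ⟨a * x + b * y, c * x + d * y, u * z⟩ := key
  have hmul : ∀ x y z x' y' z', f (⟨x, y, z⟩ * ⟨x', y', z'⟩) =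
    ⟨a * x + b * y, c * x + d * y, u * z⟩ * ⟨a * x' + b * y', c * x' + d * y', u * z'⟩ := by
    intro x y z x' y' z'
    rw [map_mul, key, key]
  have hmul' : ∀ x y z x' y' z', (⟨x, y, z⟩ * ⟨x', y', z'⟩ : s.Carrier) =
    ⟨x + s.χ z * x' + s.δ * y * (s.η z * y'), y + s.η z * y', z + z' + p * (s.ε * z * z')⟩ :=
    fun _ _ _ _ _ _ => rfl
  have huu : IsUnit u := (isUnit_iff_modP_ne_zero u).mpr hu
  have hε := congrArg Carrier.z (hmul 0 0 1 0 0 1)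
  have hyy := hmul 0 1 0 0 1 0
  have hxx := hmul 1 0 0 1 0 0
  have hx := hmul 0 0 1 1 0 0
  have hy := hmul 0 0 1 0 1 0
  rw [hmul', key] at hyy hxx hx hy hε
  have hyyx := congrArg Carrier.x hyy
  have hyyy := congrArg Carrier.y hyy
  have hxxx := congrArg Carrier.x hxx
  have hxx' := congrArg Carrier.x hx
  have hxy' := congrArg Carrier.y hx
  have hyx' := congrArg Carrier.x hy
  have hyy' := congrArg Carrier.y hy
  simp only [mul_x, mul_y, mul_z, mul_zero, mul_one, zero_mul, add_zero, zero_add, χ_zero,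
    η_zero, one_mul] at hyyx hyyy hxxx hxx' hxy' hyx' hyy' hε
  have h1 : a * s.δ = t.δ * d * d := by linear_combination hyyx
  have h2 : c * s.δ = 0 := by linear_combination hyyy
  have h3 : t.δ * c * c = 0 := by linear_combination -hxxx
  have h4 : s.δ = 0 ↔ t.δ = 0 := by
    constructor
    · intro h
      rw [h, mul_zero] at h1
      by_contra h5
      have hc : c = 0 := by simpa [h5] using h3
      have hd : d = 0 := by simpa [h5] using h1.symm
      exact hdet (by rw [hc, hd]; ring)
    · intro h
      rw [h, zero_mul, zero_mul] at h1
      by_contra h5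
      have hc : c = 0 := by simpa [h5] using h2
      have ha : a = 0 := by simpa [h5] using h1
      exact hdet (by rw [hc, ha]; ring)
  have hi : ∀ v w : ZMod p, s.ψ (v * modP p 1) = t.ψ (w * modP p u) → v = modP p u * w := by
    intro v w h
    rw [← hψ] at h
    have := hinj h
    rwa [map_one, mul_one, mul_comm] at this
  refine ⟨u, hu, ?_, h4, ?_, fun h => ?_⟩
  · apply huu.mul_left_cancel
    linear_combination hε
  · rcases eq_or_swap_of_intertwine hdet hxx' hyx' hxy' hyy' with ⟨h, h'⟩ | ⟨h, h'⟩
    · exact .inl ⟨hi _ _ h, hi _ _ h'⟩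
    · exact .inr ⟨hi _ _ h, hi _ _ h'⟩
  -- When `δ ≠ 0` the first axis is spanned by products, so it is preserved and the swap is
  -- excluded.
  · have hc : c = 0 := by simpa [h] using h2
    have hd : d ≠ 0 := fun hd => hdet (by rw [hc, hd]; ring)
    exact hi _ _ (mul_left_cancel₀ hd (hyy'.trans (mul_comm _ _)))

/-- The elements with `z = 0` are killed by `q`, so they are mapped to such elements, by an
invertible matrix. Conjugation by `(0, 0, 1)` and by its image `g` must correspond under this
matrix. -/
theorem relation_of_mulEquiv (hpq : p ≠ q) {s t : BraceParam p q} (hψ : s.ψ = t.ψ)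
    (hinj : Function.Injective s.ψ) (hs : s.ε = 0) (hs' : s.δ = 0) (ht : t.ε = 0) (ht' : t.δ = 0)
    (f : s.Carrier ≃* t.Carrier) :
    ∃ u : ZMod p, u ≠ 0 ∧ ((s.i = u * t.i ∧ s.j = u * t.j) ∨ (s.i = u * t.j ∧ s.j = u * t.i)) := by
  have hco : p.Coprime q := (Nat.coprime_primes Fact.out Fact.out).mpr hpq
  have hadd : ∀ x y x' y', (⟨x, y, 0⟩ * ⟨x', y', 0⟩ : s.Carrier) = ⟨x + x', y + y', 0⟩ := by
    intro x y x' y'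
    ext <;> simp [mul_x, mul_y, mul_z, χ_zero, η_zero, hs']
  have hpow : ∀ x y (n : ℕ), (⟨x, y, 0⟩ ^ n : s.Carrier) = ⟨n * x, n * y, 0⟩ := by
    intro x y n
    induction n with
    | zero => ext <;> simp [one_x, one_y, one_z]
    | succ n ih =>
      rw [pow_succ, ih, hadd]
      ext <;> push_cast <;> ring
  have hz : ∀ x y, (f ⟨x, y, 0⟩).z = 0 := by
    intro x y
    have h1 : (f ⟨x, y, 0⟩) ^ q = 1 := by
      rw [← map_pow, hpow]
      simp only [CharP.cast_eq_zero, zero_mul]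
      exact map_one f
    have h2 := congrArg Carrier.z h1
    rw [pow_z_of_ε_eq_zero ht, one_z] at h2
    exact ((ZMod.isUnit_iff_coprime q (p ^ 2)).mpr
      (hco.symm.pow_right 2)).mul_right_eq_zero.mp h2
  have hxy : ∀ x y x' y', (f ⟨x + x', y + y', 0⟩).x = (f ⟨x, y, 0⟩).x + (f ⟨x', y', 0⟩).x ∧
      (f ⟨x + x', y + y', 0⟩).y = (f ⟨x, y, 0⟩).y + (f ⟨x', y', 0⟩).y := by
    intro x y x' y'
    rw [← hadd, map_mul, mul_x, mul_y, hz, χ_zero, η_zero, ht']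
    constructor <;> ring
  let fxx : ZMod q →+ ZMod q := AddMonoidHom.mk' (fun x => (f ⟨x, 0, 0⟩).x) fun x y => by
    rw [← (hxy _ _ _ _).1, zero_add]
  let fxy : ZMod q →+ ZMod q := AddMonoidHom.mk' (fun x => (f ⟨x, 0, 0⟩).y) fun x y => by
    rw [← (hxy _ _ _ _).2, zero_add]
  let fyx : ZMod q →+ ZMod q := AddMonoidHom.mk' (fun x => (f ⟨0, x, 0⟩).x) fun x y => by
    rw [← (hxy _ _ _ _).1, zero_add]
  let fyy : ZMod q →+ ZMod q := AddMonoidHom.mk' (fun x => (f ⟨0, x, 0⟩).y) fun x y => by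
    rw [← (hxy _ _ _ _).2, zero_add]
  obtain ⟨a, ha⟩ : ∃ a, ∀ x, (f ⟨x, 0, 0⟩).x = a * x := ⟨_, addMonoidHom_apply_eq_mul fxx⟩
  obtain ⟨c, hc⟩ : ∃ a, ∀ x, (f ⟨x, 0, 0⟩).y = a * x := ⟨_, addMonoidHom_apply_eq_mul fxy⟩
  obtain ⟨b, hb⟩ : ∃ a, ∀ x, (f ⟨0, x, 0⟩).x = a * x := ⟨_, addMonoidHom_apply_eq_mul fyx⟩
  obtain ⟨d, hd⟩ : ∃ a, ∀ x, (f ⟨0, x, 0⟩).y = a * x := ⟨_, addMonoidHom_apply_eq_mul fyy⟩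
  have key : ∀ x y, f ⟨x, y, 0⟩ = ⟨a * x + b * y, c * x + d * y, 0⟩ := by
    intro x y
    ext
    · have := (hxy x 0 0 y).1
      rwa [add_zero, zero_add, ha, hb] at this
    · have := (hxy x 0 0 y).2
      rwa [add_zero, zero_add, hc, hd] at this
    · exact hz x y
  have hdet : a * d - b * c ≠ 0 := det_ne_zero_of_injective fun x y h1 h2 => by
    have h3 : f ⟨x, y, 0⟩ = 1 := by rw [key, h1, h2]; rfl
    rw [EmbeddingLike.map_eq_one_iff] at h3
    exact ⟨congrArg Carrier.x h3, congrArg Carrier.y h3⟩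
  obtain ⟨g, hg⟩ : ∃ g, f ⟨0, 0, 1⟩ = g := ⟨_, rfl⟩
  -- With `ε = 0` the `z`-coordinate is a homomorphism. If `g.z` were zero modulo `p`, every element
  -- in the image of `f` would have `z ≡ 0`, contradicting surjectivity.
  have hgz : modP p g.z ≠ 0 := by
    intro h
    obtain ⟨k, hk⟩ := f.surjective ⟨0, 0, 1⟩
    obtain ⟨n, hn⟩ := ZMod.natCast_zmod_surjective k.z
    have hgen : k = ⟨k.x, k.y, 0⟩ * ⟨0, 0, 1⟩ ^ n := by
      have hpz : ∀ m : ℕ, (⟨0, 0, 1⟩ ^ m : s.Carrier) = ⟨0, 0, m⟩ := by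
        intro m
        induction m with
        | zero => ext <;> simp [one_x, one_y, one_z]
        | succ m ih =>
          rw [pow_succ, ih]
          ext <;> simp [mul_x, mul_y, mul_z, hs, hs']
      rw [hpz]
      ext <;> simp [mul_x, mul_y, mul_z, hs', hn]
    have h1 := congrArg Carrier.z hk
    rw [hgen, map_mul, map_pow, hg, key, mul_z, pow_z_of_ε_eq_zero ht, ht] at h1
    have h2 := congrArg (modP p) h1
    simp only [zero_mul, mul_zero, add_zero, zero_add, map_mul, h, map_one] at h2
    exact zero_ne_one h2
  have hconj : ∀ x y, (⟨0, 0, 1⟩ * ⟨x, y, 0⟩ : s.Carrier) =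
      ⟨s.χ 1 * x, s.η 1 * y, 0⟩ * ⟨0, 0, 1⟩ := by
    intro x y
    ext <;> simp [mul_x, mul_y, mul_z, hs']
  have hx := congrArg f (hconj 1 0)
  have hy := congrArg f (hconj 0 1)
  rw [map_mul, map_mul, hg, key, key] at hx hy
  have hxx := congrArg Carrier.x hx
  have hxy' := congrArg Carrier.y hx
  have hyx := congrArg Carrier.x hy
  have hyy := congrArg Carrier.y hy
  simp only [mul_x, mul_y, mul_zero, mul_one, zero_mul, add_zero, zero_add, χ_zero,
    η_zero, one_mul, ht'] at hxx hxy' hyx hyy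
  have hi : ∀ v w : ZMod p, s.ψ (v * modP p 1) = t.ψ (w * modP p g.z) →
      v = modP p g.z * w := by
    intro v w h
    rw [← hψ] at h
    have := hinj h
    rwa [map_one, mul_one, mul_comm] at this
  refine ⟨modP p g.z, hgz, ?_⟩
  rcases eq_or_swap_of_intertwine hdet (x := s.χ 1) (y := s.η 1) (x' := t.χ g.z) (y' := t.η g.z)
    (by linear_combination -hxx) (by linear_combination -hyx) (by linear_combination -hxy')
    (by linear_combination -hyy) with ⟨h, h'⟩ | ⟨h, h'⟩
  · exact .inl ⟨hi _ _ h, hi _ _ h'⟩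
  · exact .inr ⟨hi _ _ h, hi _ _ h'⟩

theorem nonempty_mulEquiv_semidirectM (l : (ZMod q)ˣ)
    (hl : orderOf l = p) (i j : ℤ)
    (s : BraceParam p q) (hψ : ∀ n : ℤ, s.ψ n = ((l ^ n : (ZMod q)ˣ) : ZMod q)) (hε : s.ε = 0)
    (hδ : s.δ = 0) (hi : s.i = i) (hj : s.j = j) :
    Nonempty (SemidirectM p q l hl i j ≃* s.Carrier) := by
  have hpow : ∀ (k : ℤ) (z : ZMod (p ^ 2)),
      s.ψ (k * modP p z) = (((l ^ k) ^ z.val : (ZMod q)ˣ) : ZMod q) := by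
    intro k z
    have : (k : ZMod p) * modP p z = ((k * z.val : ℤ) : ZMod p) := by
      push_cast
      conv_lhs => rw [← ZMod.natCast_zmod_val z, map_natCast]
    rw [this, hψ, zpow_mul, zpow_natCast]
  refine ⟨⟨⟨fun g => ⟨g.left.toAdd 0, g.left.toAdd 1, g.right.toAdd⟩,
    fun a => ⟨.ofAdd ![a.x, a.y], .ofAdd a.z⟩, fun g => ?_, fun a => rfl⟩, fun g h => ?_⟩⟩
  · refine SemidirectProduct.ext ?_ rfl
    refine Multiplicative.toAdd.injective (funext fun k => ?_)
    fin_cases k <;> rfl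
  · have hact : ∀ k : Fin 2, (g * h).left.toAdd k = g.left.toAdd k +
        ((![(l ^ i) ^ g.right.toAdd.val, (l ^ j) ^ g.right.toAdd.val] k : (ZMod q)ˣ) : ZMod q) *
          h.left.toAdd k := by
      intro k
      rw [SemidirectProduct.mul_left, toAdd_mul, Pi.add_apply]
      congr 1
      refine (congrArg (fun M : GL (Fin 2) (ZMod q) => M.val.mulVec h.left.toAdd k)
        (diagGL_pow (l ^ i) (l ^ j) g.right.toAdd.val)).trans ?_
      simp only [diagGL, Matrix.mulVec_diagonal]
      fin_cases k <;> rfl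
    ext
    · simp only [mul_x, χ, hi, hpow, hδ, hact]
      simp
    · simp only [mul_y, η, hj, hpow, hact]
      simp
    · simp only [mul_z, hε]
      simp

/-- The additive group of the braces. -/
def addEquiv (hpq : p ≠ q) (s : BraceParam p q) : ZMod (p ^ 2 * q) × ZMod q ≃+ s.Carrier :=
  have hco : (p ^ 2).Coprime q :=
    ((Nat.coprime_primes Fact.out Fact.out).mpr hpq).pow_left 2
  { toFun := fun a => ⟨(ZMod.chineseRemainder hco a.1).2, a.2, (ZMod.chineseRemainder hco a.1).1⟩
    invFun := fun a => ((ZMod.chineseRemainder hco).symm (a.z, a.x), a.y)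
    left_inv := fun a => by simp
    right_inv := fun a => by simp
    map_add' := fun a b => by ext <;> simp [add_x, add_y, add_z] }

theorem nonempty_mulEquiv_multiplicative (hpq : p ≠ q) (s : BraceParam p q)
    (hε : s.ε = 0) (hδ : s.δ = 0) (hi : s.i = 0) (hj : s.j = 0) :
    Nonempty (Multiplicative (ZMod (p ^ 2 * q) × ZMod q) ≃* s.Carrier) := by
  have hmul : ∀ a b : s.Carrier, a + b = a * b := fun a b => by
    ext
    · simp [mul_x, add_x, χ, hi, hδ]
    · simp [mul_y, add_y, η, hj]
    · simp [mul_z, add_z, hε]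
  exact ⟨⟨Multiplicative.toAdd.trans (s.addEquiv hpq).toEquiv, fun a b =>
    ((s.addEquiv hpq).map_add a.toAdd b.toAdd).trans (hmul _ _)⟩⟩

end BraceParam

/-! ### The maps `λ_a` and the two primary subbraces. -/

namespace LeftBrace

section General

variable {B : Type*} [LeftBrace B]

theorem one_eq_zero : (1 : B) = 0 := by
  have h := brace_compat (1 : B) 0 0
  simpa only [one_mul, add_zero, zero_add] using h

/-- The map `λ_a : b ↦ a * b - a`. -/
def lam (a : B) : B →+ B :=
  AddMonoidHom.mk' (fun b => a * b - a) fun b c => by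
    rw [eq_sub_of_add_eq (brace_compat a b c)]
    abel

theorem mul_eq_add_lam (a b : B) : a * b = a + lam a b :=
  (add_sub_cancel a (a * b)).symm

/-- Compare the expansions of `(a * b) * c` and `a * (b * c)`. -/
theorem lam_mul (a b c : B) : lam (a * b) c = lam a (lam b c) := by
  have h1 := mul_eq_add_lam (a * b) c
  have h2 := mul_eq_add_lam a (b * c)
  rw [← mul_assoc, h1, mul_eq_add_lam b c, map_add, ← add_assoc, ← mul_eq_add_lam a b] at h2
  exact add_left_cancel h2

theorem lam_one (b : B) : lam 1 b = b := by
  have h := mul_eq_add_lam 1 b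
  rw [one_mul] at h
  nth_rewrite 2 [h]
  rw [one_eq_zero, zero_add]

end General

theorem exists_matrix_of_addMonoidHom {p q : ℕ} [Fact p.Prime] [Fact q.Prime] (hpq : p ≠ q)
    (f : (Fin 2 → ZMod q) × ZMod (p ^ 2) →+ (Fin 2 → ZMod q) × ZMod (p ^ 2)) :
    ∃ (M : Matrix (Fin 2) (Fin 2) (ZMod q)) (c : ZMod (p ^ 2)),
      ∀ v, f v = (M.mulVec v.1, c * v.2) := by
  have hco : p.Coprime q := (Nat.coprime_primes Fact.out Fact.out).mpr hpq
  let g : (Fin 2 → ZMod q) →+ (Fin 2 → ZMod q) :=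
    (AddMonoidHom.fst _ _).comp (f.comp (AddMonoidHom.inl _ _))
  let k : ZMod (p ^ 2) →+ ZMod (p ^ 2) :=
    (AddMonoidHom.snd _ _).comp (f.comp (AddMonoidHom.inr _ _))
  refine ⟨LinearMap.toMatrix' (g.toZModLinearMap q), k 1, fun v => ?_⟩
  have h1 : (f (v.1, 0)).2 = 0 := by
    have h2 : (q : ZMod (p ^ 2)) * (f (v.1, 0)).2 = 0 := by
      rw [← nsmul_eq_mul, ← Prod.smul_snd, ← map_nsmul]
      have : q • ((v.1, 0) : (Fin 2 → ZMod q) × ZMod (p ^ 2)) = 0 := by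
        ext <;> simp
      rw [this, map_zero, Prod.snd_zero]
    exact ((ZMod.isUnit_iff_coprime q (p ^ 2)).mpr
      (hco.symm.pow_right 2)).mul_right_eq_zero.mp h2
  have h2 : (f (0, v.2)).1 = 0 := by
    funext n
    exact BraceParam.addMonoidHom_eq_zero_of_coprime (hco.pow_left 2)
      ((Pi.evalAddMonoidHom _ n).comp ((AddMonoidHom.fst _ _).comp (f.comp (AddMonoidHom.inr _ _))))
      v.2
  have h3 : (f (v.1, 0)).1 = (LinearMap.toMatrix' (g.toZModLinearMap q)).mulVec v.1 := by
    rw [LinearMap.toMatrix'_mulVec]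
    rfl
  have h4 : (f (0, v.2)).2 = k 1 * v.2 := BraceParam.addMonoidHom_apply_eq_mul k v.2
  have h5 : f v = f (v.1, 0) + f (0, v.2) := by
    rw [← map_add]
    simp
  rw [h5]
  ext n
  · rw [Prod.fst_add, h2, h3, add_zero]
  · rw [Prod.snd_add, h1, h4, zero_add]

variable {p q : ℕ} [Fact p.Prime] [Fact q.Prime] {B : Type*} [LeftBrace B]

/-- Each `λ_a` is block diagonal because `p` and `q` are coprime; multiplicativity of the blocks is
`lam_mul` evaluated on generators. -/
theorem exists_coordinates (hpq : p ≠ q) (e : B ≃+ (Fin 2 → ZMod q) × ZMod (p ^ 2)) :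
    ∃ (A : B →* Matrix (Fin 2) (Fin 2) (ZMod q)) (c : B →* ZMod (p ^ 2)),
      ∀ a b, e (a * b) = ((e a).1 + (A a).mulVec (e b).1, (e a).2 + c a * (e b).2) := by
  have h : ∀ a : B, ∃ (M : Matrix (Fin 2) (Fin 2) (ZMod q)) (c : ZMod (p ^ 2)),
      ∀ b, e (lam a b) = (M.mulVec (e b).1, c * (e b).2) := by
    intro a
    obtain ⟨M, c, h⟩ := exists_matrix_of_addMonoidHom hpq
      (e.toAddMonoidHom.comp ((lam a).comp e.symm.toAddMonoidHom))
    refine ⟨M, c, fun b => ?_⟩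
    rw [← h (e b)]
    simp
  choose A c h using h
  have hV : ∀ (a : B) (v : Fin 2 → ZMod q), (e (lam a (e.symm (v, 0)))).1 = (A a).mulVec v := by
    intro a v
    rw [h, e.apply_symm_apply]
  have hZ : ∀ (a : B), (e (lam a (e.symm (0, 1)))).2 = c a := by
    intro a
    rw [h, e.apply_symm_apply, mul_one]
  refine ⟨⟨⟨A, ?_⟩, fun a b => ?_⟩, ⟨⟨c, ?_⟩, fun a b => ?_⟩, fun a b => ?_⟩
  · refine Matrix.ext_of_mulVec_single fun i => ?_
    rw [← hV, lam_one, e.apply_symm_apply, Matrix.one_mulVec]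
  · refine Matrix.ext_of_mulVec_single fun i => ?_
    dsimp only
    rw [← hV, lam_mul, h, h, e.apply_symm_apply, Matrix.mulVec_mulVec]
  · rw [← hZ, lam_one, e.apply_symm_apply]
  · dsimp only
    rw [← hZ, lam_mul, h, h, e.apply_symm_apply, mul_one]
  · rw [mul_eq_add_lam, map_add, h]
    rfl

/-- An additive subgroup stable under all `λ_a` is a multiplicative subgroup. -/
def subgroupOfStable (H : AddSubgroup B) (hH : ∀ a, ∀ b ∈ H, lam a b ∈ H) : Subgroup B where
  carrier := H
  mul_mem' {a b} ha hb := by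
    rw [mul_eq_add_lam]
    exact H.add_mem ha (hH _ _ hb)
  one_mem' := by
    rw [one_eq_zero]
    exact H.zero_mem
  inv_mem' {a} ha := by
    have h := mul_eq_add_lam a⁻¹ a
    rw [inv_mul_cancel, one_eq_zero] at h
    rw [eq_neg_of_add_eq_zero_left h.symm]
    exact H.neg_mem (hH _ _ ha)

/-- A stable additive subgroup is also a multiplicative one, and groups of order `r²` are abelian.
-/
theorem pow_eq_one_and_commute_of_stable (r : ℕ) [Fact r.Prime] (H : AddSubgroup B)
    (hH : ∀ a, ∀ b ∈ H, lam a b ∈ H) (hc : Nat.card H = r ^ 2) :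
    (∀ a ∈ H, a ^ r ^ 2 = 1) ∧ ∀ a ∈ H, ∀ b ∈ H, a * b = b * a := by
  have hc' : Nat.card (subgroupOfStable H hH) = r ^ 2 := hc
  refine ⟨fun a ha => ?_, fun a ha b hb => ?_⟩
  · have h : (⟨a, ha⟩ : subgroupOfStable H hH) ^ r ^ 2 = 1 := hc' ▸ pow_card_eq_one'
    exact congrArg Subtype.val h
  · have hcomm := IsPGroup.isMulCommutative_of_card_eq_prime_sq hc'
    have h := hcomm.is_comm.comm (⟨a, ha⟩ : subgroupOfStable H hH) ⟨b, hb⟩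
    exact congrArg Subtype.val h

theorem pow_eq_one_and_commute (e : B ≃+ (Fin 2 → ZMod q) × ZMod (p ^ 2))
    (A : B →* Matrix (Fin 2) (Fin 2) (ZMod q)) (c : B →* ZMod (p ^ 2))
    (h : ∀ a b, e (a * b) = ((e a).1 + (A a).mulVec (e b).1, (e a).2 + c a * (e b).2)) :
    ((∀ a, (e a).2 = 0 → a ^ q ^ 2 = 1) ∧
      ∀ a b, (e a).2 = 0 → (e b).2 = 0 → a * b = b * a) ∧
    (∀ a, (e a).1 = 0 → a ^ p ^ 2 = 1) ∧
      ∀ a b, (e a).1 = 0 → (e b).1 = 0 → a * b = b * a := by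
  have hl : ∀ a b, e (lam a b) = ((A a).mulVec (e b).1, c a * (e b).2) := by
    intro a b
    have h1 := h a b
    rw [mul_eq_add_lam, map_add] at h1
    exact add_left_cancel (a := e a) h1
  constructor
  · let f : B →+ ZMod (p ^ 2) := (AddMonoidHom.snd _ _).comp e.toAddMonoidHom
    have hf : ∀ a, a ∈ f.ker ↔ (e a).2 = 0 := fun a => Iff.rfl
    have hcard : Nat.card f.ker = q ^ 2 := by
      have : f.ker ≃ (Fin 2 → ZMod q) :=
        ⟨fun a => (e a.1).1, fun v => ⟨e.symm (v, 0), by rw [hf]; simp⟩,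
          fun a => Subtype.ext (e.injective (by
            rw [e.apply_symm_apply]; exact Prod.ext rfl ((hf _).mp a.2).symm)), fun v => by simp⟩
      rw [Nat.card_congr this]
      simp
    obtain ⟨h1, h2⟩ := pow_eq_one_and_commute_of_stable q f.ker (fun a b hb => by
      rw [hf] at hb ⊢
      rw [hl, hb, mul_zero]) hcard
    exact ⟨fun a ha => h1 a ((hf a).mpr ha), fun a b ha hb =>
      h2 a ((hf a).mpr ha) b ((hf b).mpr hb)⟩
  · let f : B →+ (Fin 2 → ZMod q) := (AddMonoidHom.fst _ _).comp e.toAddMonoidHom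
    have hf : ∀ a, a ∈ f.ker ↔ (e a).1 = 0 := fun a => Iff.rfl
    have hcard : Nat.card f.ker = p ^ 2 := by
      have : f.ker ≃ ZMod (p ^ 2) :=
        ⟨fun a => (e a.1).2, fun v => ⟨e.symm (0, v), by rw [hf]; simp⟩,
          fun a => Subtype.ext (e.injective (by
            rw [e.apply_symm_apply]; exact Prod.ext ((hf _).mp a.2).symm rfl)), fun v => by simp⟩
      rw [Nat.card_congr this]
      simp
    obtain ⟨h1, h2⟩ := pow_eq_one_and_commute_of_stable p f.ker (fun a b hb => by
      rw [hf] at hb ⊢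
      rw [hl, hb, Matrix.mulVec_zero]) hcard
    exact ⟨fun a ha => h1 a ((hf a).mpr ha), fun a b ha hb =>
      h2 a ((hf a).mpr ha) b ((hf b).mpr hb)⟩

/-- Trace and determinant vanish, so this is Cayley–Hamilton, checked entry by entry. -/
theorem sq_eq_zero_of_isNilpotent {F : Type*} [Field F] (M : Matrix (Fin 2) (Fin 2) F)
    (h : IsNilpotent M) : M * M = 0 := by
  have h1 : M.trace = 0 := (Matrix.isNilpotent_trace_of_isNilpotent h).eq_zero
  have h2 : M.det = 0 := by
    obtain ⟨n, hn⟩ := h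
    refine IsReduced.eq_zero _ ⟨n, ?_⟩
    rw [← Matrix.det_pow, hn, Matrix.det_zero]
  rw [Matrix.trace_fin_two] at h1
  rw [Matrix.det_fin_two] at h2
  ext i j
  rw [Matrix.mul_apply, Fin.sum_univ_two]
  fin_cases i <;> fin_cases j <;> simp
  · linear_combination M 0 0 * h1 - h2
  · linear_combination M 0 1 * h1
  · linear_combination M 1 0 * h1
  · linear_combination M 1 1 * h1 - h2

/-- The unit group has order `p(p - 1)`, which is prime to `q` because `p < q`. -/
theorem eq_one_of_pow_prime_sq (hpq : p < q) (c : ZMod (p ^ 2)) (h : c ^ q ^ 2 = 1) : c = 1 := by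
  have hq : q.Prime := Fact.out
  have hp : p.Prime := Fact.out
  have hu : IsUnit c := IsUnit.of_pow_eq_one h (pow_ne_zero _ hq.ne_zero)
  obtain ⟨u, rfl⟩ := hu
  have h1 : u ^ q ^ 2 = 1 := Units.ext (by simpa using h)
  have h2 := ZMod.pow_totient u
  rw [Nat.totient_prime_pow hp two_pos] at h2
  have h3 : (q ^ 2).Coprime (p ^ (2 - 1) * (p - 1)) := by
    refine Nat.Coprime.pow_left 2 (Nat.Coprime.mul_right ?_ ?_)
    · exact ((Nat.coprime_primes hq hp).mpr hpq.ne').pow_right _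
    · exact (hq.coprime_iff_not_dvd).mpr fun h =>
        absurd (Nat.le_of_dvd (Nat.sub_pos_of_lt hp.one_lt) h) (by omega)
  have h4 : orderOf u ∣ 1 := h3 ▸ Nat.dvd_gcd (orderOf_dvd_of_pow_eq_one h1)
    (orderOf_dvd_of_pow_eq_one h2)
  rw [orderOf_eq_one_iff.mp (Nat.dvd_one.mp h4), Units.val_one]

/-- Modulo `p` the power map is the identity, so `c ≡ 1`. Only `τ` modulo `p` matters, so a non-unit
`τ` can be replaced by `0`. -/
theorem exists_eq_mul_of_pow_prime_sq (c : ZMod (p ^ 2)) (h : c ^ p ^ 2 = 1) :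
    ∃ τ : ZMod (p ^ 2), c = 1 + (p : ZMod (p ^ 2)) * τ ∧ (τ = 0 ∨ IsUnit τ) := by
  have h1 : modP p c = 1 := by
    have := congrArg (modP p) h
    rwa [map_pow, map_one, ZMod.pow_card_pow] at this
  obtain ⟨n, hn⟩ := ZMod.natCast_zmod_surjective (c - 1)
  have h2 : modP p (c - 1) = 0 := by rw [map_sub, h1, map_one, sub_self]
  rw [← hn, map_natCast, ZMod.natCast_eq_zero_iff] at h2
  obtain ⟨m, rfl⟩ := h2
  by_cases h0 : modP p m = 0
  · refine ⟨0, ?_, .inl rfl⟩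
    rw [Nat.cast_mul, (natCast_mul_eq_zero_iff _).mpr h0] at hn
    linear_combination -hn
  · refine ⟨m, ?_, .inr ((isUnit_iff_modP_ne_zero _).mpr h0)⟩
    rw [Nat.cast_mul] at hn
    linear_combination -hn

end LeftBrace

/-! ### Bilinear product on `(ℤ/(q))²` and action of `ℤ/(p²)`. -/

namespace LeftBrace

variable {p q : ℕ} [Fact p.Prime] [Fact q.Prime] {B : Type*} [LeftBrace B]

/-- The product of a brace with additive group `(ℤ/(q))² × ℤ/(p²)`, in terms of a bilinear product
on `(ℤ/(q))²` and an action of `ℤ/(p²)`. -/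
theorem exists_bilinear_and_action (hq : q ≠ 2) (hpq : p < q)
    (e : B ≃+ (Fin 2 → ZMod q) × ZMod (p ^ 2)) :
    ∃ (β : (Fin 2 → ZMod q) → Matrix (Fin 2) (Fin 2) (ZMod q))
      (ρ : ZMod (p ^ 2) → Matrix (Fin 2) (Fin 2) (ZMod q)) (τ : ZMod (p ^ 2)),
      (τ = 0 ∨ IsUnit τ) ∧
      (∀ v w, (β v).mulVec w = (β w).mulVec v) ∧
      (∀ u v w, (β u).mulVec ((β v).mulVec w) = 0) ∧
      (∀ z, ρ z ^ p ^ 2 = 1) ∧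
      (∀ z w, ρ (z + w + (p : ZMod (p ^ 2)) * (τ * z * w)) = ρ z * ρ w) ∧
      (∀ z v w, (ρ z).mulVec ((β v).mulVec w) = (β ((ρ z).mulVec v)).mulVec ((ρ z).mulVec w)) ∧
      ∀ a b, e (a * b) = ((e a).1 + (ρ (e a).2).mulVec (e b).1 +
        (β (e a).1).mulVec ((ρ (e a).2).mulVec (e b).1),
        (e a).2 + (e b).2 + (p : ZMod (p ^ 2)) * (τ * (e a).2 * (e b).2)) := by
  obtain ⟨A, c, h⟩ := exists_coordinates hpq.ne e
  obtain ⟨⟨hQ1, hQ2⟩, hP1, hP2⟩ := pow_eq_one_and_commute e A c h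
  obtain ⟨V, hV⟩ : ∃ V : (Fin 2 → ZMod q) → B, ∀ v, e (V v) = (v, 0) :=
    ⟨fun v => e.symm (v, 0), fun v => e.apply_symm_apply _⟩
  obtain ⟨Z, hZ⟩ : ∃ Z : ZMod (p ^ 2) → B, ∀ z, e (Z z) = (0, z) :=
    ⟨fun v => e.symm (0, v), fun v => e.apply_symm_apply _⟩
  have hcV : ∀ v, c (V v) = 1 := fun v => eq_one_of_pow_prime_sq hpq _ (by
    rw [← map_pow, hQ1 _ (by rw [hV]), map_one])
  obtain ⟨τ, hτ, hτ'⟩ := exists_eq_mul_of_pow_prime_sq (c (Z 1)) (by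
    rw [← map_pow, hP1 _ (by rw [hZ]), map_one])
  have hcZ : ∀ z, c (Z z) = 1 + p * (τ * z) := by
    intro z
    -- Commutativity of the `p`-part reads `z + c(Z z) = 1 + c(Z 1)z`, so the value at `1`
    -- determines `c`.
    have h1 := congrArg e (hP2 (Z z) (Z 1) (by rw [hZ]) (by rw [hZ]))
    rw [h, h, hZ, hZ] at h1
    have h2 := congrArg Prod.snd h1
    dsimp only at h2
    rw [hτ] at h2
    linear_combination h2
  have hdec : ∀ a, a = V (e a).1 * Z (e a).2 := by
    intro a
    apply e.injective
    rw [h, hV, hZ, hcV]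
    ext <;> simp
  have hA : ∀ a, A a = A (V (e a).1) * A (Z (e a).2) := fun a => by
    rw [← map_mul, ← hdec]
  have hc : ∀ a, c a = 1 + p * (τ * (e a).2) := fun a => by
    conv_lhs => rw [hdec a, map_mul, hcV, hcZ, one_mul]
  obtain ⟨β, hβ⟩ : ∃ β : (Fin 2 → ZMod q) → Matrix (Fin 2) (Fin 2) (ZMod q),
    ∀ v, A (V v) = 1 + β v := ⟨fun v => A (V v) - 1, fun v => (add_sub_cancel 1 (A (V v))).symm⟩
  have hβs : ∀ v w, (β v).mulVec w = (β w).mulVec v := by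
    intro v w
    have h1 := congrArg e (hQ2 (V v) (V w) (by rw [hV]) (by rw [hV]))
    rw [h, h, hV, hV, hβ, hβ] at h1
    have h2 := congrArg Prod.fst h1
    simp only [Matrix.add_mulVec, Matrix.one_mulVec] at h2
    rw [← add_assoc, ← add_assoc, add_comm w v] at h2
    exact add_left_cancel h2
  have hβadd : ∀ v w, β (v + w) = β v + β w := by
    intro v w
    refine Matrix.ext_of_mulVec_single fun i => ?_
    rw [hβs, Matrix.mulVec_add, hβs, hβs _ w, Matrix.add_mulVec]
  have hβ2 : ∀ v, β v * β v = 0 := by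
    intro v
    refine sq_eq_zero_of_isNilpotent _ ⟨q ^ 2, ?_⟩
    have h1 : A (V v) ^ q ^ 2 = 1 := by rw [← map_pow, hQ1 _ (by rw [hV]), map_one]
    -- In characteristic `q`, the `q²`-th power of `A(V v) - 1` is `A(V v)^(q²) - 1 = 0`.
    rw [← add_sub_cancel_left 1 (β v), ← hβ, sub_pow_char_pow_of_commute _ _ (Commute.one_right _),
      h1, one_pow, sub_self]
  have hVV : ∀ v w, V v * V w = V (v + w + (β v).mulVec w) := by
    intro v w
    apply e.injective
    rw [h, hV, hV, hV, hβ]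
    simp [Matrix.add_mulVec, add_assoc]
  have hββ : ∀ v w, β ((β v).mulVec w) = β v * β w := by
    intro v w
    -- Multiplicativity of `A` becomes associativity of the bilinear product.
    have h1 := congrArg A (hVV v w)
    rw [map_mul, hβ, hβ, hβ, hβadd, hβadd, mul_add, mul_one, add_mul, one_mul] at h1
    have h2 : 1 + β v + β w + β v * β w = 1 + β v + β w + β ((β v).mulVec w) := by
      rw [add_assoc, h1]
      abel
    exact (add_left_cancel h2).symm
  have hβ3 : ∀ u v, β u * β v = 0 := by
    intro u v
    -- Polarisation: the squares vanish and the operators commute, so `2 β(u) β(v) = 0`.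
    have h1 := hβ2 (u + v)
    rw [hβadd, mul_add, add_mul, add_mul, hβ2, hβ2, zero_add, add_zero] at h1
    have h2 : β v * β u = β u * β v := by rw [← hββ, hβs, hββ]
    rw [h2, ← two_smul (ZMod q)] at h1
    have h3 : (2 : ZMod q) ≠ 0 := Ring.two_ne_zero (by rwa [ZMod.ringChar_zmod_n])
    exact (smul_eq_zero_iff_right h3).mp h1
  have hconj : ∀ z v, Z z * V v = V ((A (Z z)).mulVec v) * Z z := by
    intro z v
    apply e.injective
    rw [h, h, hV, hV, hZ, hcV]
    ext <;> simp
  have hZZ : ∀ z w, Z z * Z w = Z (z + w + p * (τ * z * w)) := by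
    intro z w
    apply e.injective
    rw [h, hZ, hZ, hZ, hcZ]
    ext
    · simp
    · dsimp only
      ring
  refine ⟨β, fun z => A (Z z), τ, hτ', hβs, fun u v w => ?_, fun z => ?_, fun z w => ?_,
    fun z v w => ?_, fun a b => ?_⟩
  · rw [Matrix.mulVec_mulVec, hβ3, Matrix.zero_mulVec]
  · rw [← map_pow, hP1 _ (by rw [hZ]), map_one]
  · rw [← map_mul, hZZ]
  · have h1 := congrArg (fun M => (A M).mulVec w) (hconj z v)
    simp only [map_mul, hβ, mul_add, add_mul, mul_one, one_mul, Matrix.add_mulVec] at h1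
    rw [Matrix.mulVec_mulVec, Matrix.mulVec_mulVec]
    exact add_left_cancel h1
  · rw [h, hA, hc, hβ, add_mul, one_mul, Matrix.add_mulVec, ← add_assoc, Matrix.mulVec_mulVec]
    refine Prod.ext rfl ?_
    dsimp only
    ring

/-- In the basis `b = β(a)a`, `a` the matrix is triangular: `Mb = d²b` and `Ma = kb + da`. Its order
is prime to `q`, so `k` can be removed. -/
theorem exists_eigenbasis_of_ne_zero (hp : p ≠ q) (hq : q ≠ 2)
    (β : (Fin 2 → ZMod q) → Matrix (Fin 2) (Fin 2) (ZMod q)) (M : Matrix (Fin 2) (Fin 2) (ZMod q))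
    (hs : ∀ v w, (β v).mulVec w = (β w).mulVec v)
    (h3 : ∀ u v w, (β u).mulVec ((β v).mulVec w) = 0) (hM : M ^ p ^ 2 = 1)
    (hMβ : ∀ v w, M.mulVec ((β v).mulVec w) = (β (M.mulVec v)).mulVec (M.mulVec w))
    (h0 : ∃ v w, (β v).mulVec w ≠ 0) :
    ∃ (a : Fin 2 → ZMod q) (d : ZMod q), (β a).mulVec a ≠ 0 ∧ d ^ p ^ 2 = 1 ∧ M.mulVec a = d • a := by
  have h2 : (2 : ZMod q) ≠ 0 := Ring.two_ne_zero (by rwa [ZMod.ringChar_zmod_n])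
  have hadd : ∀ u v w, (β (u + v)).mulVec w = (β u).mulVec w + (β v).mulVec w := by
    intro u v w
    rw [hs, Matrix.mulVec_add, hs w, hs w]
  have hsmul : ∀ (k : ZMod q) v w, (β (k • v)).mulVec w = k • (β v).mulVec w := by
    intro k v w
    rw [hs, Matrix.mulVec_smul, hs w]
  -- A symmetric bilinear map with zero diagonal vanishes, as `2` is invertible.
  obtain ⟨a, ha⟩ : ∃ a, (β a).mulVec a ≠ 0 := by
    by_contra! h
    obtain ⟨v, w, hvw⟩ := h0
    have h1 := h (v + w)
    rw [hadd, Matrix.mulVec_add, Matrix.mulVec_add, h, h, hs w v, zero_add, add_zero,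
      ← two_smul (ZMod q)] at h1
    exact hvw ((smul_eq_zero_iff_right h2).mp h1)
  set b := (β a).mulVec a with hb
  have hβb : ∀ w, (β b).mulVec w = 0 := fun w => by rw [hs, hb, h3]
  have hind : LinearIndependent (ZMod q) ![b, a] := by
    rw [LinearIndependent.pair_iff]
    intro s t hst
    have h1 := congrArg (fun v => (β a).mulVec v) hst
    simp only [Matrix.mulVec_add, Matrix.mulVec_smul, Matrix.mulVec_zero] at h1
    rw [hb, h3, smul_zero, zero_add] at h1
    have ht : t = 0 := (smul_eq_zero_iff_left ha).mp h1
    rw [ht, zero_smul, add_zero] at hst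
    exact ⟨(smul_eq_zero_iff_left ha).mp hst, ht⟩
  obtain ⟨k, d, hkd⟩ : ∃ k d : ZMod q, M.mulVec a = k • b + d • a := by
    have h1 : Submodule.span (ZMod q) (Set.range ![b, a]) = ⊤ :=
      hind.span_eq_top_of_card_eq_finrank (by simp)
    have h2 : M.mulVec a ∈ Submodule.span (ZMod q) (Set.range ![b, a]) := h1 ▸ Submodule.mem_top
    rw [Matrix.range_cons, Matrix.range_cons, Matrix.range_empty, Set.union_empty,
      Set.singleton_union, Submodule.mem_span_pair] at h2
    obtain ⟨k, d, h⟩ := h2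
    exact ⟨k, d, h.symm⟩
  have hMb : M.mulVec b = d ^ 2 • b := by
    rw [hb, hMβ, hkd, hadd, hsmul, hsmul, hβb, smul_zero, zero_add, Matrix.mulVec_add,
      Matrix.mulVec_smul, Matrix.mulVec_smul, hs a b, hβb, smul_zero, zero_add, smul_smul, pow_two]
  have hpow : ∀ n : ℕ, ∃ m : ZMod q, (M ^ n).mulVec a = m • b + d ^ n • a := by
    intro n
    induction n with
    | zero => exact ⟨0, by simp⟩
    | succ n ih =>
      obtain ⟨m, hm⟩ := ih
      refine ⟨m * d ^ 2 + d ^ n * k, ?_⟩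
      rw [pow_succ', ← Matrix.mulVec_mulVec, hm, Matrix.mulVec_add, Matrix.mulVec_smul,
        Matrix.mulVec_smul, hkd, hMb]
      module
  have hd : d ^ p ^ 2 = 1 := by
    obtain ⟨m, hm⟩ := hpow (p ^ 2)
    rw [hM, Matrix.one_mulVec] at hm
    have h4 := LinearIndependent.pair_iff.mp hind m (d ^ p ^ 2 - 1) (by
      rw [sub_smul, one_smul, ← add_sub_assoc, ← hm, sub_self])
    exact sub_eq_zero.mp h4.2
  by_cases hd1 : d = 1
  · refine ⟨a, 1, ha, one_pow _, ?_⟩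
    -- If `d = 1` the matrix is unipotent, and `M ^ p² = 1` gives `p²k = 0`, hence `k = 0`.
    have hpow : ∀ n : ℕ, (M ^ n).mulVec a = (n * k) • b + a := by
      intro n
      induction n with
      | zero => simp
      | succ n ih =>
        rw [pow_succ', ← Matrix.mulVec_mulVec, ih, Matrix.mulVec_add, Matrix.mulVec_smul,
          hkd, hMb, hd1]
        push_cast
        module
    have h5 := hpow (p ^ 2)
    rw [hM, Matrix.one_mulVec] at h5
    have h6 : (((p ^ 2 : ℕ) : ZMod q) * k) • b = 0 := by
      rwa [right_eq_add] at h5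
    have h7 : ((p ^ 2 : ℕ) : ZMod q) ≠ 0 := by
      rw [Ne, ZMod.natCast_eq_zero_iff]
      intro h
      exact hp ((Nat.prime_dvd_prime_iff_eq Fact.out Fact.out).mp
        ((Fact.out : q.Prime).dvd_of_dvd_pow h)).symm
    have h8 : k = 0 := by
      have := (smul_eq_zero_iff_left ha).mp h6
      exact (mul_eq_zero.mp this).resolve_left h7
    rw [hkd, h8, hd1, zero_smul, zero_add]
  · have hd0 : d ≠ 0 := by
      rintro rfl
      rw [zero_pow (pow_ne_zero _ (Fact.out : p.Prime).ne_zero)] at hd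
      exact zero_ne_one hd
    have hdd : d - d ^ 2 ≠ 0 := by
      rw [pow_two, ← mul_one_sub]
      exact mul_ne_zero hd0 (sub_ne_zero.mpr (Ne.symm hd1))
    -- The two eigenvalues differ, and this `m` makes `a + mb` an eigenvector for `d`.
    obtain ⟨m, hm⟩ : ∃ m, m * (d - d ^ 2) = k := ⟨k / (d - d ^ 2), div_mul_cancel₀ _ hdd⟩
    refine ⟨a + m • b, d, ?_, hd, ?_⟩
    · rw [hadd, hsmul, hβb, smul_zero, add_zero, Matrix.mulVec_add, Matrix.mulVec_smul, hs a b,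
        hβb, smul_zero, add_zero]
      exact ha
    · rw [Matrix.mulVec_add, Matrix.mulVec_smul, hkd, hMb, ← hm]
      module

end LeftBrace

/-! ### Diagonalisation by Sylow's theorem. -/

section Diagonalization

/-- The diagonal embedding `Rˣ × Rˣ → GL(2, R)`. -/
def diagHom (R : Type) [CommRing R] : Rˣ × Rˣ →* GL (Fin 2) R where
  toFun x := diagGL x.1 x.2
  map_one' := by
    apply Units.ext
    ext i j
    fin_cases i <;> fin_cases j <;> simp [diagGL]
  map_mul' x y := by
    apply Units.ext
    ext i j
    fin_cases i <;> fin_cases j <;> simp [diagGL]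

theorem diagHom_injective (R : Type) [CommRing R] : Function.Injective (diagHom R) := by
  intro x y h
  have h1 := congrArg (fun M : GL (Fin 2) R => M.val 0 0) h
  have h2 := congrArg (fun M : GL (Fin 2) R => M.val 1 1) h
  simp only [diagHom, diagGL, MonoidHom.coe_mk, OneHom.coe_mk, Matrix.diagonal_apply_eq] at h1 h2
  exact Prod.ext (Units.ext h1) (Units.ext h2)

variable {p q : ℕ} [Fact p.Prime] [Fact q.Prime]

/-- The order is `q(q + 1)(q - 1)²`, and `p` divides only `q - 1`, exactly once. -/
theorem factorization_card_GL (h1 : p ∣ q - 1) (h2 : ¬ p ∣ q + 1) (h3 : ¬ p ^ 2 ∣ q - 1) :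
    (Nat.card (GL (Fin 2) (ZMod q))).factorization p = 2 := by
  have hp : p.Prime := Fact.out
  have hq : q.Prime := Fact.out
  have hq0 : q - 1 ≠ 0 := (Nat.sub_pos_of_lt hq.one_lt).ne'
  have hcard : Nat.card (GL (Fin 2) (ZMod q)) = q * ((q + 1) * ((q - 1) * (q - 1))) := by
    rw [Matrix.card_GL_field, Fin.prod_univ_two]
    simp only [ZMod.card, Fin.val_zero, Fin.val_one, pow_zero, pow_one]
    obtain ⟨n, rfl⟩ := Nat.exists_eq_add_of_le' hq.one_le
    have e1 : (n + 1) ^ 2 - 1 = n * (n + 2) := by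
      rw [Nat.sub_eq_iff_eq_add (Nat.one_le_pow _ _ n.succ_pos)]
      simp only [Nat.succ_eq_add_one]
      ring
    have e2 : (n + 1) ^ 2 - (n + 1) = n * (n + 1) := by
      rw [Nat.sub_eq_iff_eq_add (Nat.le_self_pow two_ne_zero _)]
      ring
    rw [e1, e2, Nat.add_sub_cancel]
    ring
  have hpq : ¬ p ∣ q := by
    intro h
    have h4 := Nat.dvd_sub h h1
    rw [Nat.sub_sub_self hq.one_le] at h4
    exact hp.one_lt.ne' (Nat.dvd_one.mp h4)
  have hfac : (q - 1).factorization p = 1 := by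
    refine le_antisymm ?_ ((hp.dvd_iff_one_le_factorization hq0).mp h1)
    by_contra! h
    exact h3 ((hp.pow_dvd_iff_le_factorization hq0).mpr h)
  rw [hcard, Nat.factorization_mul hq.ne_zero (by positivity), Nat.factorization_mul (by positivity)
    (by positivity), Nat.factorization_mul hq0 hq0]
  simp only [Finsupp.add_apply, hfac, Nat.factorization_eq_zero_of_not_dvd hpq,
    Nat.factorization_eq_zero_of_not_dvd h2, zero_add, Nat.reduceAdd]

/-- An element of `GL(2, q)` of `p`-power order is conjugate to a diagonal matrix. -/
theorem exists_conj_diagGL (h1 : p ∣ q - 1) (h2 : ¬ p ∣ q + 1) (h3 : ¬ p ^ 2 ∣ q - 1)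
    (l : (ZMod q)ˣ) (hl : orderOf l = p) (M : GL (Fin 2) (ZMod q)) (hM : M ^ p ^ 2 = 1) :
    ∃ (N : GL (Fin 2) (ZMod q)) (a b : (ZMod q)ˣ), a ∈ Subgroup.zpowers l ∧
      b ∈ Subgroup.zpowers l ∧ M * N = N * diagGL a b := by
  classical
  -- The diagonal matrices with entries in `⟨l⟩` number `p²`, so they form a Sylow subgroup, and `M`
  -- lies in a conjugate of it.
  let H := ((Subgroup.zpowers l).prod (Subgroup.zpowers l)).map (diagHom (ZMod q))
  have hH : Nat.card H = p ^ (Nat.card (GL (Fin 2) (ZMod q))).factorization p := by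
    rw [factorization_card_GL h1 h2 h3, Subgroup.card_map_of_injective (diagHom_injective _),
      Nat.card_congr (Subgroup.prodEquiv _ _).toEquiv, Nat.card_prod, Nat.card_zpowers, hl, pow_two]
  let S : Sylow p (GL (Fin 2) (ZMod q)) := Sylow.ofCard H hH
  have hM' : IsPGroup p (Subgroup.zpowers M) := by
    apply IsPGroup.of_card_dvd_pow (n := 2)
    rw [Nat.card_zpowers]
    exact orderOf_dvd_of_pow_eq_one hM
  obtain ⟨T, hT⟩ := hM'.exists_le_sylow
  obtain ⟨N, hN⟩ := MulAction.exists_smul_eq (GL (Fin 2) (ZMod q)) S T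
  have h4 : M ∈ (T : Subgroup (GL (Fin 2) (ZMod q))) := hT (Subgroup.mem_zpowers M)
  rw [← hN, Sylow.coe_subgroup_smul, Subgroup.mem_pointwise_smul_iff_inv_smul_mem] at h4
  obtain ⟨⟨a, b⟩, hab, h5⟩ := (h4 : _ ∈ H)
  refine ⟨N, a, b, hab.1, hab.2, ?_⟩
  have h6 : diagGL a b = N⁻¹ * M * N := by
    rw [← map_inv, MulAut.smul_def, MulAut.conj_apply, inv_inv] at h5
    exact h5
  rw [h6]
  group

end Diagonalization

section Eigenbasis

variable {p q : ℕ} [Fact p.Prime] [Fact q.Prime]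

/-- Since `p²` does not divide `q - 1`, such an element is already a `p`-th root of unity, and `l`
generates those. -/
theorem mem_zpowers_of_pow_prime_sq (h3 : ¬ p ^ 2 ∣ q - 1) (l : (ZMod q)ˣ)
    (hl : orderOf l = p) (d : (ZMod q)ˣ) (hd : d ^ p ^ 2 = 1) : d ∈ Subgroup.zpowers l := by
  have hp : p.Prime := Fact.out
  obtain ⟨k, hk, hdk⟩ := (Nat.dvd_prime_pow hp).mp (orderOf_dvd_of_pow_eq_one hd)
  have hd1 : orderOf d ∣ q - 1 := orderOf_dvd_of_pow_eq_one (ZMod.units_pow_card_sub_one_eq_one q d)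
  have hk1 : k ≤ 1 := by
    by_contra! h
    have : k = 2 := by omega
    subst this
    exact h3 (hdk ▸ hd1)
  have h4 : d ^ p = 1 := by
    rw [← orderOf_dvd_iff_pow_eq_one, hdk]
    exact (pow_dvd_pow p hk1).trans (by rw [pow_one])
  have hprim : IsPrimitiveRoot l p := hl ▸ IsPrimitiveRoot.orderOf l
  rwa [hprim.zpowers_eq, mem_rootsOfUnity]

theorem exists_eigenbasis (h1 : p ∣ q - 1) (h2 : ¬ p ∣ q + 1) (h3 : ¬ p ^ 2 ∣ q - 1) (hpq : p ≠ q)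
    (hq : q ≠ 2) (l : (ZMod q)ˣ) (hl : orderOf l = p) (ψ : AddChar (ZMod p) (ZMod q))
    (hψ : ∀ n : ℤ, ψ n = ((l ^ n : (ZMod q)ˣ) : ZMod q))
    (β : (Fin 2 → ZMod q) → Matrix (Fin 2) (Fin 2) (ZMod q)) (M : Matrix (Fin 2) (Fin 2) (ZMod q))
    (hs : ∀ v w, (β v).mulVec w = (β w).mulVec v)
    (h0 : ∀ u v w, (β u).mulVec ((β v).mulVec w) = 0) (hM : M ^ p ^ 2 = 1)
    (hMβ : ∀ v w, M.mulVec ((β v).mulVec w) = (β (M.mulVec v)).mulVec (M.mulVec w)) :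
    ∃ (v w : Fin 2 → ZMod q) (δ : ZMod q) (i j : ZMod p), (δ = 0 ∨ δ = 1) ∧ (δ = 0 ∨ i = 2 * j) ∧
      LinearIndependent (ZMod q) ![v, w] ∧ M.mulVec v = ψ i • v ∧ M.mulVec w = ψ j • w ∧
      (β v).mulVec v = 0 ∧ (β v).mulVec w = 0 ∧ (β w).mulVec w = δ • v := by
  by_cases hβ : ∃ v w, (β v).mulVec w ≠ 0
  · obtain ⟨a, d, ha, hd, hMa⟩ := LeftBrace.exists_eigenbasis_of_ne_zero hpq hq β M hs h0 hM hMβ hβ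
    obtain ⟨d, rfl⟩ := IsUnit.of_pow_eq_one hd (pow_ne_zero _ (Fact.out : p.Prime).ne_zero)
    obtain ⟨n, hn⟩ := mem_zpowers_of_pow_prime_sq h3 l hl d (Units.ext (by simpa using hd))
    have hj : ψ n = d := by rw [hψ, ← hn]
    -- Taking `β(a)a` itself as first basis vector normalises `δ` to `1`; its eigenvalue is `d²`.
    refine ⟨(β a).mulVec a, a, 1, 2 * n, n, .inr rfl, .inr rfl, ?_, ?_, ?_, ?_, ?_, ?_⟩
    · rw [LinearIndependent.pair_iff]
      intro s t hst
      have h1 := congrArg (fun v => (β a).mulVec v) hst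
      simp only [Matrix.mulVec_add, Matrix.mulVec_smul, Matrix.mulVec_zero] at h1
      rw [h0, smul_zero, zero_add] at h1
      have ht : t = 0 := (smul_eq_zero_iff_left ha).mp h1
      rw [ht, zero_smul, add_zero] at hst
      exact ⟨(smul_eq_zero_iff_left ha).mp hst, ht⟩
    · rw [hMβ, hMa, Matrix.mulVec_smul, hs, Matrix.mulVec_smul, smul_smul, two_mul,
        AddChar.map_add_eq_mul, hj]
    · rw [hMa, hj]
    · rw [hs, h0]
    · rw [hs, h0]
    · rw [one_smul]
  · push Not at hβ
    let M' : GL (Fin 2) (ZMod q) := Units.ofPowEqOne M _ hM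
      (pow_ne_zero _ (Fact.out : p.Prime).ne_zero)
    have hM' : M' ^ p ^ 2 = 1 := Units.ext (by simp [M'])
    obtain ⟨N, a, b, ⟨m, hm⟩, ⟨n, hn⟩, hN⟩ := exists_conj_diagGL h1 h2 h3 l hl M' hM'
    have hMN : M * N.val = N.val * Matrix.diagonal ![(a : ZMod q), (b : ZMod q)] :=
      congrArg Units.val hN
    have hcol : ∀ k : Fin 2, M.mulVec (N.val.col k) =
        (![(a : ZMod q), (b : ZMod q)] k) • N.val.col k := by
      intro k
      rw [← Matrix.mulVec_single_one, Matrix.mulVec_mulVec, hMN, ← Matrix.mulVec_mulVec,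
        Matrix.diagonal_mulVec_single, mul_one, ← Matrix.mulVec_smul]
      congr 1
      rw [← Pi.single_smul, smul_eq_mul, mul_one]
    refine ⟨N.val.col 0, N.val.col 1, 0, m, n, .inl rfl, .inl rfl, ?_, ?_, ?_, hβ _ _, hβ _ _, ?_⟩
    · have := Matrix.linearIndependent_cols_iff_isUnit.mpr N.isUnit
      convert this using 1
      funext k
      fin_cases k <;> rfl
    · rw [hcol, hψ, ← hm]
      rfl
    · rw [hcol, hψ, ← hn]
      rfl
    · rw [hβ, zero_smul]

end Eigenbasis

/-! ### Reduction of an arbitrary brace to a model. -/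

namespace LeftBrace

variable {p q : ℕ} [Fact p.Prime] [Fact q.Prime]

/-- The action of `ℤ/(p²)` is determined by a single matrix. -/
theorem exists_generator (hp : p ≠ 2) {R : Type*} [Monoid R] (ρ : ZMod (p ^ 2) → R)
    (τ : ZMod (p ^ 2)) (h0 : ∀ z, ρ z ^ p ^ 2 = 1)
    (h : ∀ z w, ρ (z + w + (p : ZMod (p ^ 2)) * (τ * z * w)) = ρ z * ρ w) :
    ∃ z₀, ∀ z, ∃ n : ℕ, ρ z = ρ z₀ ^ n ∧ (n : ZMod p) = modP p z := by
  have hpp := natCast_mul_self_zmod_sq p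
  obtain ⟨k, hk⟩ : ∃ k : ZMod (p ^ 2), 2 * k = 1 := by
    have : IsUnit (2 : ZMod (p ^ 2)) := by
      rw [isUnit_iff_modP_ne_zero, map_ofNat]
      exact Ring.two_ne_zero (by rwa [ZMod.ringChar_zmod_n])
    obtain ⟨u, hu⟩ := this
    exact ⟨↑u⁻¹, by rw [← hu, Units.mul_inv]⟩
  -- `g z = z + pτz²/2` is a homomorphism from `(ℤ/(p²), +)` to the operation `z + w + pτzw`, so `ρ
  -- ∘ g` consists of powers of `ρ (g 1)`.
  obtain ⟨g, hg⟩ : ∃ g : ZMod (p ^ 2) → ZMod (p ^ 2), ∀ z, g z = z + (p : ZMod (p ^ 2)) * (τ * k * z ^ 2) :=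
    ⟨_, fun _ => rfl⟩
  have hgg : ∀ z w, g (z + w) = g z + g w + (p : ZMod (p ^ 2)) * (τ * g z * g w) := by
    intro z w
    simp only [hg]
    linear_combination (p * τ * z * w) * hk - (τ ^ 2 * k * z * w * (z + w) +
      p * τ ^ 3 * k ^ 2 * z ^ 2 * w ^ 2) * hpp
  have hρ0 : ρ 0 = 1 := by
    have h1 := h 0 0
    simp only [add_zero, mul_zero] at h1
    have h2 : ρ 0 * ρ 0 ^ (p ^ 2 - 1) = 1 := by
      rw [← pow_succ', Nat.sub_add_cancel (Nat.one_le_pow _ _ (Fact.out : p.Prime).pos), h0]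
    calc ρ 0 = ρ 0 * (ρ 0 * ρ 0 ^ (p ^ 2 - 1)) := by rw [h2, mul_one]
      _ = 1 := by rw [← mul_assoc, ← h1, h2]
  have hpow : ∀ n : ℕ, ρ (g n) = ρ (g 1) ^ n := by
    intro n
    induction n with
    | zero => rw [Nat.cast_zero, hg]; simpa using hρ0
    | succ n ih => rw [Nat.cast_succ, hgg, h, ih, pow_succ (ρ (g 1)) n]
  refine ⟨g 1, fun z => ?_⟩
  -- The inverse of `g` is `z - pτz²/2`, which agrees with `z` modulo `p`.
  obtain ⟨n, hn⟩ := ZMod.natCast_zmod_surjective (z - (p : ZMod (p ^ 2)) * (τ * k * z ^ 2))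
  refine ⟨n, ?_, ?_⟩
  · rw [← hpow, hn, hg]
    congr 1
    linear_combination (2 * τ ^ 2 * k ^ 2 * z ^ 3 - p * τ ^ 3 * k ^ 3 * z ^ 4) * hpp
  · have h1 := congrArg (modP p) hn
    rwa [map_natCast, map_sub, map_mul, modP_natCast_self, zero_mul, sub_zero] at h1

theorem exists_param_of_addEquiv (h1 : p ∣ q - 1) (h2 : ¬ p ∣ q + 1) (h3 : ¬ p ^ 2 ∣ q - 1)
    (hp : p ≠ 2) (hq : q ≠ 2) (hpq : p < q)
    (l : (ZMod q)ˣ) (hl : orderOf l = p) (ψ : AddChar (ZMod p) (ZMod q))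
    (hψ : ∀ n : ℤ, ψ n = ((l ^ n : (ZMod q)ˣ) : ZMod q)) (B : BundledBrace)
    (e : B ≃+ (Fin 2 → ZMod q) × ZMod (p ^ 2)) :
    ∃ s : BraceParam p q, s.ψ = ψ ∧ (s.ε = 0 ∨ IsUnit s.ε) ∧ (s.δ = 0 ∨ s.δ = 1) ∧
      s.toBrace ≈ B := by
  obtain ⟨β, ρ, τ, hτ, hs, h0, hρ, hρρ, hβ, hmul⟩ := exists_bilinear_and_action hq hpq e
  obtain ⟨z₀, hz₀⟩ := exists_generator hp ρ τ hρ hρρ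
  obtain ⟨v, w, δ, i, j, hδ, hij, hind, hv, hw, hvv, hvw, hww⟩ :=
    exists_eigenbasis h1 h2 h3 hpq.ne hq l hl ψ hψ β (ρ z₀) hs h0 (hρ z₀) (hβ z₀)
  have heig : ∀ (x : Fin 2 → ZMod q) (k : ZMod p), (ρ z₀).mulVec x = ψ k • x →
      ∀ z, (ρ z).mulVec x = ψ (k * modP p z) • x := by
    intro x k hx z
    obtain ⟨n, hn, hn'⟩ := hz₀ z
    rw [hn, ← hn', mul_comm, ← nsmul_eq_mul, AddChar.map_nsmul_eq_pow]
    clear hn hn'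
    induction n with
    | zero => simp
    | succ n ih => rw [pow_succ', ← Matrix.mulVec_mulVec, ih, Matrix.mulVec_smul, hx, smul_smul,
        pow_succ]
  let s : BraceParam p q := ⟨ψ, τ, δ, i, j, hij⟩
  let f : s.Carrier → B := fun a => e.symm (a.x • v + a.y • w, a.z)
  have hf : ∀ a, e (f a) = (a.x • v + a.y • w, a.z) := fun a => e.apply_symm_apply _
  have hadd : ∀ a b, f (a + b) = f a + f b := by
    intro a b
    apply e.injective
    rw [map_add, hf, hf, hf, Prod.mk_add_mk]
    refine Prod.ext ?_ rfl
    dsimp only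
    rw [BraceParam.add_x, BraceParam.add_y]
    module
  have hmul' : ∀ a b, f (a * b) = f a * f b := by
    intro a b
    apply e.injective
    rw [hmul, hf, hf, hf]
    refine Prod.ext ?_ rfl
    dsimp only
    have hadd : ∀ u v w, (β (u + v)).mulVec w = (β u).mulVec w + (β v).mulVec w := by
      intro u v w
      rw [hs, Matrix.mulVec_add, hs w, hs w]
    have hsmul : ∀ (k : ZMod q) v w, (β (k • v)).mulVec w = k • (β v).mulVec w := by
      intro k v w
      rw [hs, Matrix.mulVec_smul, hs w]
    have hρb : (ρ a.z).mulVec (b.x • v + b.y • w) = (b.x * s.χ a.z) • v + (b.y * s.η a.z) • w := by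
      rw [Matrix.mulVec_add, Matrix.mulVec_smul, Matrix.mulVec_smul, heig v i hv, heig w j hw,
        smul_smul, smul_smul]
      rfl
    rw [hρb, hadd, hsmul, hsmul, Matrix.mulVec_add, Matrix.mulVec_smul, Matrix.mulVec_smul,
      Matrix.mulVec_add, Matrix.mulVec_smul, Matrix.mulVec_smul, hvv, hvw, hs w v, hvw, hww,
      BraceParam.mul_x, BraceParam.mul_y]
    change _ = _ + _ + (_ + _ • (_ + _ • (s.δ • v)))
    module
  have hinj : Function.Injective f := by
    intro a b hab
    have h4 := congrArg e hab
    rw [hf, hf] at h4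
    have h5 := congrArg Prod.fst h4
    have h6 := congrArg Prod.snd h4
    dsimp only at h5 h6
    have h7 := LinearIndependent.pair_iff.mp hind (a.x - b.x) (a.y - b.y) (by
      rw [← sub_eq_zero] at h5
      rw [← h5]
      module)
    exact BraceParam.Carrier.ext (sub_eq_zero.mp h7.1) (sub_eq_zero.mp h7.2) h6
  have hfin : Finite s.Carrier := Finite.of_equiv _ (BraceParam.Carrier.equivProd s).symm
  have hbij : Function.Bijective f :=
    ⟨hinj, hinj.surjective_of_finite ((BraceParam.Carrier.equivProd s).trans e.symm.toEquiv)⟩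
  exact ⟨s, rfl, hτ, hδ, ⟨(⟨Equiv.ofBijective f hbij, hmul', hadd⟩ : s.Carrier ≃+* B)⟩⟩

end LeftBrace

/-! ### Complete invariants of the models. -/

section Invariants

variable {p : ℕ}

/-- Pairs of exponents up to order and common multiples by units; they classify the groups
`SemidirectM`. -/
def exponentSetoid (p : ℕ) : Setoid (ZMod p × ZMod p) where
  r x y := ∃ u : (ZMod p)ˣ, (x.1 = u * y.1 ∧ x.2 = u * y.2) ∨ (x.1 = u * y.2 ∧ x.2 = u * y.1)
  iseqv :=
    { refl := fun x => ⟨1, by simp⟩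
      symm := by
        rintro x y ⟨u, ⟨h1, h2⟩ | ⟨h1, h2⟩⟩ <;> refine ⟨u⁻¹, ?_⟩ <;> simp [h1, h2]
      trans := by
        rintro x y z ⟨u, ⟨h1, h2⟩ | ⟨h1, h2⟩⟩ ⟨v, ⟨h3, h4⟩ | ⟨h3, h4⟩⟩ <;> refine ⟨u * v, ?_⟩ <;>
          simp [h1, h2, h3, h4, mul_assoc] }

/-- The classes of pairs of exponents. -/
abbrev ExponentClass (p : ℕ) : Type := Quotient (exponentSetoid p)

/-- The class of a pair of exponents. -/
def exponentClass {p : ℕ} (i j : ZMod p) : ExponentClass p := Quotient.mk (exponentSetoid p) (i, j)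

theorem exponentClass_eq_iff {i j i' j' : ZMod p} :
    exponentClass i j = exponentClass i' j' ↔ ∃ u : (ZMod p)ˣ,
      (i = u * i' ∧ j = u * j') ∨ (i = u * j' ∧ j = u * i') :=
  Quotient.eq (r := exponentSetoid p)

theorem exponentClass_swap (i j : ZMod p) : exponentClass i j = exponentClass j i :=
  exponentClass_eq_iff.mpr ⟨1, by simp⟩

theorem exponentClass_surjective (x : ExponentClass p) : ∃ i j, exponentClass i j = x := by
  induction x using Quotient.ind with
  | _ a => exact ⟨a.1, a.2, rfl⟩

variable [Fact p.Prime]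

/-- Parameters of braces: whether `ℤ/(p²)` has nontrivial product, and the exponents of the action
on a trivial (`inl`) or nontrivial (`inr`) brace `(ℤ/(q))²`. -/
abbrev BraceCode (p : ℕ) : Type := Bool × ((ZMod p × ZMod p) ⊕ ZMod p)

/-- Complete invariants of the braces. -/
abbrev BraceInvariant (p : ℕ) : Type := ExponentClass p ⊕ Sym2 (ZMod p) ⊕ Bool ⊕ ZMod p

/-- The brace parameters of a code. -/
def BraceCode.param {q : ℕ} (ψ : AddChar (ZMod p) (ZMod q)) : BraceCode p → BraceParam p q
  | (b, .inl x) => ⟨ψ, if b then 1 else 0, 0, x.1, x.2, .inl rfl⟩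
  | (b, .inr j) => ⟨ψ, if b then 1 else 0, 1, 2 * j, j, .inr rfl⟩

/-- The invariant of the brace with the given code. -/
def BraceCode.invariant : BraceCode p → BraceInvariant p
  | (false, .inl x) => .inl (exponentClass x.1 x.2)
  | (true, .inl x) => .inr (.inl s(x.1, x.2))
  | (false, .inr j) => .inr (.inr (.inl (decide (j = 0))))
  | (true, .inr j) => .inr (.inr (.inr j))

/-- The class of the multiplicative group in terms of the invariant of the brace. -/
def BraceInvariant.exponents : BraceInvariant p → ExponentClass p
  | .inl x => x
  | .inr (.inl s) => Sym2.lift ⟨exponentClass, exponentClass_swap⟩ s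
  | .inr (.inr (.inl b)) => if b then exponentClass 0 0 else exponentClass 2 1
  | .inr (.inr (.inr j)) => exponentClass (2 * j) j

theorem exponentClass_two_mul {j : ZMod p} (hj : j ≠ 0) :
    exponentClass (2 * j) j = exponentClass 2 1 :=
  exponentClass_eq_iff.mpr ⟨Units.mk0 j hj, .inl ⟨by rw [Units.val_mk0, mul_comm], by simp⟩⟩

theorem BraceCode.exponents_invariant {q : ℕ} (ψ : AddChar (ZMod p) (ZMod q)) (c : BraceCode p) :
    BraceInvariant.exponents (invariant c) = exponentClass (param ψ c).i (param ψ c).j := by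
  obtain ⟨_ | _, x | j⟩ := c
  · rfl
  · by_cases hj : j = 0
    · subst hj
      simp [invariant, param, BraceInvariant.exponents]
    · simp [invariant, param, BraceInvariant.exponents, hj, exponentClass_two_mul hj]
  · rfl
  · rfl

theorem BraceCode.invariant_surjective :
    Function.Surjective (invariant : BraceCode p → BraceInvariant p) := by
  rintro (x | s | b | j)
  · obtain ⟨i, j, rfl⟩ := exponentClass_surjective x
    exact ⟨(false, .inl (i, j)), rfl⟩
  · induction s using Sym2.ind with
    | _ i j => exact ⟨(true, .inl (i, j)), rfl⟩
  · cases b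
    · exact ⟨(false, .inr 1), by simp [invariant]⟩
    · exact ⟨(false, .inr 0), by simp [invariant]⟩
  · exact ⟨(true, .inr j), rfl⟩

variable {q : ℕ} [Fact q.Prime]

/-- The isomorphism class of the brace with the given code. -/
def BraceCode.toClass (ψ : AddChar (ZMod p) (ZMod q)) (c : BraceCode p) : BraceClass :=
  ⟦(param ψ c).toBrace⟧

omit [Fact q.Prime] in
theorem exists_unit_lift (u : (ZMod p)ˣ) : ∃ v : (ZMod (p ^ 2))ˣ, modP p (v : ZMod (p ^ 2)) = u := by
  obtain ⟨z, hz⟩ := modP_surjective p u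
  obtain ⟨v, rfl⟩ := (isUnit_iff_modP_ne_zero z).mpr (hz ▸ u.ne_zero)
  exact ⟨v, hz⟩

/-- If `ε = 0`, units of `ℤ/(p)` lift and scale the exponents; if `δ = 0`, the two coordinates can
be exchanged. -/
theorem BraceCode.toClass_eq_of_invariant_eq (ψ : AddChar (ZMod p) (ZMod q)) (c d : BraceCode p)
    (h : invariant c = invariant d) : toClass ψ c = toClass ψ d := by
  apply Quotient.sound
  have hu : ∀ (x y : BraceParam p q) (u : (ZMod p)ˣ), x.ψ = y.ψ → x.ε = 0 → y.ε = 0 → x.δ = y.δ →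
      x.i = u * y.i → x.j = u * y.j → x.toBrace ≈ y.toBrace := by
    intro x y u hψ hx hy hδ hi hj
    obtain ⟨v, hv⟩ := exists_unit_lift u
    exact BraceParam.ringEquiv_of_unit x y v hψ (by rw [hx, hy, zero_mul]) hδ (by rw [hv, hi])
      (by rw [hv, hj])
  obtain ⟨_ | _, x | j⟩ := c <;> obtain ⟨_ | _, y | k⟩ := d <;>
    simp only [invariant, reduceCtorEq, Sum.inl.injEq, Sum.inr.injEq] at h
  · obtain ⟨u, ⟨h1, h2⟩ | ⟨h1, h2⟩⟩ := exponentClass_eq_iff.mp h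
    · exact hu _ _ u rfl rfl rfl rfl h1 h2
    · exact Setoid.trans (hu _ (param ψ (false, .inl (y.2, y.1))) u rfl rfl rfl rfl h1 h2)
        (BraceParam.ringEquiv_of_swap _ _ rfl rfl rfl rfl rfl rfl)
  · by_cases hj : j = 0
    · have hk : k = 0 := by simpa [hj] using h
      rw [hj, hk]
    · have hk : k ≠ 0 := by simpa [hj] using h
      refine hu _ _ (Units.mk0 (j / k) (div_ne_zero hj hk)) rfl rfl rfl rfl ?_ ?_
      · change 2 * j = j / k * (2 * k)
        field_simp
      · exact (div_mul_cancel₀ j hk).symm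
  · rcases Sym2.eq_iff.mp h with ⟨h1, h2⟩ | ⟨h1, h2⟩
    · rw [show x = y from Prod.ext h1 h2]
    · exact BraceParam.ringEquiv_of_swap _ _ rfl rfl rfl rfl h1 h2
  · rw [h]

/-- Equal values `ε = 1` force `u ≡ 1` modulo `p`, which leaves no scaling; `δ = 1` leaves no swap.
-/
theorem BraceCode.invariant_eq_of_equiv (hpq : p ≠ q) {ψ : AddChar (ZMod p) (ZMod q)}
    (hψ : Function.Injective ψ) {c d : BraceCode p}
    (h : (param ψ c).toBrace ≈ (param ψ d).toBrace) : invariant c = invariant d := by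
  have hψc : ∀ c, (param ψ c).ψ = ψ := by
    rintro ⟨_, _ | _⟩ <;> rfl
  obtain ⟨u, hu, hε, hδ, hij, hj⟩ := BraceParam.relation_of_equiv hpq
    ((hψc c).trans (hψc d).symm) (by rwa [hψc]) h
  have hp1 : (p : ZMod (p ^ 2)) ≠ 0 := fun h => by
    have h1 := (natCast_mul_eq_zero_iff (1 : ZMod (p ^ 2))).mp (by rw [mul_one, h])
    rw [map_one] at h1
    exact one_ne_zero h1
  have hpu : (p : ZMod (p ^ 2)) * u ≠ 0 := fun h => hu ((natCast_mul_eq_zero_iff u).mp h)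
  have hu1 : (p : ZMod (p ^ 2)) = p * u → modP p u = 1 := by
    intro h
    have h1 := (natCast_mul_eq_zero_iff (u - 1)).mp (by rw [mul_sub, ← h, mul_one, sub_self])
    rwa [map_sub, map_one, sub_eq_zero] at h1
  obtain ⟨_ | _, x | j⟩ := c <;> obtain ⟨_ | _, y | k⟩ := d <;>
    simp [param, hp1, Ne.symm hpu] at hε hδ hij hj
  · exact congrArg Sum.inl (exponentClass_eq_iff.mpr ⟨Units.mk0 _ hu, hij⟩)
  · simp [invariant, hj, hu]
  · have h1 := hu1 hε
    simp only [h1, one_mul] at hij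
    refine congrArg (Sum.inr ∘ Sum.inl) (Sym2.eq_iff.mpr ?_)
    exact hij
  · simp [invariant, hj, hu1 hε]

theorem BraceCode.toClass_eq_iff (hpq : p ≠ q) {ψ : AddChar (ZMod p) (ZMod q)}
    (hψ : Function.Injective ψ) (c d : BraceCode p) :
    toClass ψ c = toClass ψ d ↔ invariant c = invariant d :=
  ⟨fun h => invariant_eq_of_equiv hpq hψ (Quotient.exact h), toClass_eq_of_invariant_eq ψ c d⟩

/-- A unit `ε` becomes `1` after multiplying `z` by `ε`, which divides both exponents by it. -/
theorem BraceCode.exists_toClass_eq {ψ : AddChar (ZMod p) (ZMod q)} (s : BraceParam p q)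
    (hψ : s.ψ = ψ) (hε : s.ε = 0 ∨ IsUnit s.ε) (hδ : s.δ = 0 ∨ s.δ = 1) :
    ∃ c : BraceCode p, toClass ψ c = ⟦s.toBrace⟧ := by
  have key : ∀ (i j : ZMod p) (h : s.δ = 0 ∨ i = 2 * j) (b : Bool),
      ∃ c : BraceCode p, param ψ c = ⟨ψ, if b then 1 else 0, s.δ, i, j, h⟩ := by
    intro i j h b
    rcases hδ with h0 | h1
    · exact ⟨(b, .inl (i, j)), by simp only [param, h0]⟩
    · have h2 : i = 2 * j := h.resolve_left (by rw [h1]; exact one_ne_zero)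
      exact ⟨(b, .inr j), by simp only [param, h1, h2]⟩
  rcases hε with h0 | ⟨u, hu⟩
  · obtain ⟨c, hc⟩ := key s.i s.j s.compat false
    refine ⟨c, ?_⟩
    rw [toClass, hc]
    congr 2
    obtain ⟨_, _, _, _, _, _⟩ := s
    simp_all
  · have hu0 : modP p (u : ZMod (p ^ 2)) ≠ 0 := (isUnit_iff_modP_ne_zero _).mp u.isUnit
    obtain ⟨c, hc⟩ := key ((modP p (u : ZMod (p ^ 2)))⁻¹ * s.i) ((modP p (u : ZMod (p ^ 2)))⁻¹ * s.j)
      (s.compat.imp id fun h => by rw [h]; ring) true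
    refine ⟨c, ?_⟩
    rw [toClass, hc]
    refine Quotient.sound (Setoid.symm (BraceParam.ringEquiv_of_unit _ _ u hψ ?_ rfl ?_ ?_))
    · simp [hu]
    · exact (mul_inv_cancel_left₀ hu0 _).symm
    · exact (mul_inv_cancel_left₀ hu0 _).symm

theorem bracesWithAdd_eq_range (h1 : p ∣ q - 1) (h2 : ¬ p ∣ q + 1) (h3 : ¬ p ^ 2 ∣ q - 1)
    (hp : p ≠ 2) (hq : q ≠ 2) (hpq : p < q)
    (l : (ZMod q)ˣ) (hl : orderOf l = p) (ψ : AddChar (ZMod p) (ZMod q))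
    (hψ : ∀ n : ℤ, ψ n = ((l ^ n : (ZMod q)ˣ) : ZMod q)) :
    bracesWithAdd (ZMod (p ^ 2 * q) × ZMod q) = Set.range (BraceCode.toClass ψ) := by
  ext x
  constructor
  · rintro ⟨B, rfl, ⟨e⟩⟩
    -- Any parameter would do: `t` only serves to rewrite the additive group as `(ℤ/(q))² × ℤ/(p²)`.
    let t : BraceParam p q := ⟨ψ, 0, 0, 0, 0, .inl rfl⟩
    obtain ⟨s, hs, hε, hδ, hB⟩ := LeftBrace.exists_param_of_addEquiv h1 h2 h3 hp hq hpq l hl ψ hψ B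
      ((e.trans (t.addEquiv hpq.ne)).trans (BraceParam.Carrier.equivProd t).addEquiv)
    obtain ⟨c, hc⟩ := BraceCode.exists_toClass_eq s hs hε hδ
    exact ⟨c, hc.trans (Quotient.sound hB)⟩
  · rintro ⟨c, rfl⟩
    exact ⟨_, rfl, ⟨((BraceCode.param ψ c).addEquiv hpq.ne).symm⟩⟩

/-- Each model is compared with the one having `ε = δ = 0` and the same exponents, which has the
same multiplicative group. -/
theorem bracesWithAddMul_eq_image (hp : p ≠ 2) (hq : q ≠ 2) (hpq : p ≠ q)
    (ψ : AddChar (ZMod p) (ZMod q)) (hinj : Function.Injective ψ)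
    (hrange : bracesWithAdd (ZMod (p ^ 2 * q) × ZMod q) = Set.range (BraceCode.toClass ψ))
    (G : Type) [Group G] (i j : ZMod p)
    (hG : ∀ s : BraceParam p q, s.ψ = ψ → s.ε = 0 → s.δ = 0 → s.i = i → s.j = j →
      Nonempty (G ≃* s.Carrier)) :
    bracesWithAddMul (ZMod (p ^ 2 * q) × ZMod q) G = BraceCode.toClass ψ ''
      (BraceCode.invariant ⁻¹' {x | BraceInvariant.exponents x = exponentClass i j}) := by
  have hψc : ∀ c, (BraceCode.param ψ c).ψ = ψ := by
    rintro ⟨_, _ | _⟩ <;> rfl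
  obtain ⟨f⟩ := hG (BraceCode.param ψ (false, .inl (i, j))) rfl rfl rfl rfl rfl
  have hc : ∀ c, Nonempty ((BraceCode.param ψ c).Carrier ≃*
      (BraceCode.param ψ (false, .inl ((BraceCode.param ψ c).i, (BraceCode.param ψ c).j))).Carrier) :=
    fun c => BraceParam.nonempty_mulEquiv hp hq _ _ (hψc c) rfl rfl rfl rfl
  ext x
  constructor
  · rintro ⟨B, rfl, hA, ⟨g⟩⟩
    obtain ⟨c, hcB⟩ : (⟦B⟧ : BraceClass) ∈ Set.range (BraceCode.toClass ψ) :=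
      hrange ▸ ⟨B, rfl, hA⟩
    refine ⟨c, ?_, hcB⟩
    obtain ⟨k⟩ : Nonempty ((BraceCode.param ψ c).Carrier ≃+* B) := Quotient.exact hcB
    obtain ⟨m⟩ := hc c
    obtain ⟨u, hu, huu⟩ := BraceParam.relation_of_mulEquiv hpq
      (s := BraceCode.param ψ (false, .inl ((BraceCode.param ψ c).i, (BraceCode.param ψ c).j)))
      (t := BraceCode.param ψ (false, .inl (i, j))) rfl hinj rfl rfl rfl rfl
      (((m.symm.trans k.toMulEquiv).trans g).trans f)
    rw [Set.mem_preimage, Set.mem_ofPred_eq, BraceCode.exponents_invariant ψ]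
    exact exponentClass_eq_iff.mpr ⟨Units.mk0 u hu, huu⟩
  · rintro ⟨c, h, rfl⟩
    rw [Set.mem_preimage, Set.mem_ofPred_eq, BraceCode.exponents_invariant ψ] at h
    refine ⟨_, rfl, ⟨((BraceCode.param ψ c).addEquiv hpq).symm⟩, ?_⟩
    obtain ⟨m⟩ := hc c
    obtain ⟨k⟩ : Nonempty ((BraceCode.param ψ (false, .inl ((BraceCode.param ψ c).i,
        (BraceCode.param ψ c).j))).Carrier ≃+* (BraceCode.param ψ (false, .inl (i, j))).Carrier) :=
      Quotient.exact (BraceCode.toClass_eq_of_invariant_eq ψ (false, .inl _) (false, .inl (i, j))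
        (congrArg Sum.inl h))
    exact ⟨(m.trans k.toMulEquiv).trans f.symm⟩

end Invariants

theorem ncard_image_eq_of_eq_iff {α β γ : Type*} {f : α → β} {g : α → γ}
    (h : ∀ a b, f a = f b ↔ g a = g b) (s : Set α) : (f '' s).ncard = (g '' s).ncard := by
  refine Set.ncard_congr (fun b hb => g hb.choose) (fun b hb => ⟨_, hb.choose_spec.1, rfl⟩)
    (fun b c hb hc hbc => ?_) ?_
  · rw [← hb.choose_spec.2, ← hc.choose_spec.2]
    exact (h _ _).mpr hbc
  · rintro _ ⟨a, ha, rfl⟩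
    have hb : f a ∈ f '' s := ⟨a, ha, rfl⟩
    exact ⟨f a, hb, (h _ _).mp hb.choose_spec.2⟩

/-- If the fibres of `F` are `{a, f a}`, then the image of `F` has half as many elements as the
domain and the fixed points of `f` together. -/
theorem two_mul_ncard_range {α β : Type*} [Finite α] (F : α → β) (f : α → α)
    (hF : ∀ a b, F a = F b ↔ b = a ∨ b = f a) :
    2 * (Set.range F).ncard = Nat.card α + {a | f a = a}.ncard := by
  classical
  have := Fintype.ofFinite α
  have hF' : ∀ a b, F b = F a ↔ b = a ∨ b = f a := fun a b => eq_comm.trans (hF a b)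
  have h1 : Fintype.card α = ∑ b ∈ Finset.univ.image F, (Finset.univ.filter (F · = b)).card :=
    Finset.card_eq_sum_card_image F Finset.univ
  have h2 : (Finset.univ.filter (fun a => f a = a)).card = ∑ b ∈ Finset.univ.image F,
      ((Finset.univ.filter (fun a => f a = a)).filter (F · = b)).card :=
    Finset.card_eq_sum_card_fiberwise fun a _ => by simp
  have h3 : (Set.range F).ncard = (Finset.univ.image F).card := by
    rw [← Set.ncard_coe_finset, Finset.coe_image, Finset.coe_univ, Set.image_univ]
  have h4 : {a | f a = a}.ncard = (Finset.univ.filter (fun a => f a = a)).card := by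
    rw [← Set.ncard_coe_finset]
    congr 1
    ext a
    simp
  rw [h3, h4, Nat.card_eq_fintype_card, h1, h2, ← Finset.sum_add_distrib, mul_comm]
  -- Each fibre contributes two: a fixed point counts in both sums, while a fibre of two elements
  -- contains no fixed point.
  refine (Finset.sum_const_nat fun b hb => ?_).symm
  obtain ⟨a, -, rfl⟩ := Finset.mem_image.mp hb
  by_cases ha : f a = a
  · have e1 : Finset.univ.filter (F · = F a) = {a} := by
      ext b
      simp [hF', ha]
    have e2 : (Finset.univ.filter (fun a => f a = a)).filter (F · = F a) = {a} := by
      ext b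
      simp only [Finset.mem_filter, Finset.mem_univ, true_and, Finset.mem_singleton,
        hF', ha, or_self]
      exact ⟨And.right, fun h => ⟨h ▸ ha, h⟩⟩
    rw [e1, e2, Finset.card_singleton]
  · have e1 : Finset.univ.filter (F · = F a) = {a, f a} := by
      ext b
      simp [hF']
    have e2 : (Finset.univ.filter (fun a => f a = a)).filter (F · = F a) = ∅ := by
      ext b
      simp only [Finset.mem_filter, Finset.mem_univ, true_and, Finset.notMem_empty, iff_false,
        hF']
      rintro ⟨hfb, h | h⟩ <;> subst h
      · exact ha hfb
      · have h5 : F (f a) = F a := ((hF a (f a)).mpr (.inr rfl)).symm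
        rcases (hF _ _).mp h5 with h6 | h6
        · exact ha h6.symm
        · exact ha (h6.trans hfb).symm
    rw [e1, e2, Finset.card_pair (Ne.symm ha), Finset.card_empty]

/-! ### Counting invariants and their fibres. -/

section Counting

variable {p : ℕ} [Fact p.Prime]

theorem card_units_zmod : Nat.card (ZMod p)ˣ = p - 1 := by
  rw [Nat.card_eq_fintype_card, ZMod.card_units]

theorem exponentClass_eq_zero_iff {i j : ZMod p} :
    exponentClass i j = exponentClass 0 0 ↔ i = 0 ∧ j = 0 := by
  rw [exponentClass_eq_iff]
  constructor
  · rintro ⟨u, ⟨h1, h2⟩ | ⟨h1, h2⟩⟩ <;> simp [h1, h2]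
  · rintro ⟨rfl, rfl⟩
    exact ⟨1, .inl ⟨(mul_zero _).symm, (mul_zero _).symm⟩⟩

theorem two_ne_zero_zmod (hp : p ≠ 2) : (2 : ZMod p) ≠ 0 :=
  Ring.two_ne_zero (by rwa [ZMod.ringChar_zmod_n])

/-- Apart from the classes of `(0, 0)` and `(0, 1)`, every class contains some `(1, k)`, with `k`
unique up to inversion; the fixed points of inversion are `1` and `-1`. -/
theorem two_mul_card_exponentClass (hp : p ≠ 2) : 2 * Nat.card (ExponentClass p) = p + 5 := by
  have h2 := two_ne_zero_zmod hp
  let F : (ZMod p)ˣ → ExponentClass p := fun k => exponentClass 1 k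
  have hF : 2 * (Set.range F).ncard = Nat.card (ZMod p)ˣ + {a : (ZMod p)ˣ | a⁻¹ = a}.ncard := by
    refine two_mul_ncard_range F _ fun a b => ?_
    constructor
    · intro h
      obtain ⟨u, ⟨h1, h3⟩ | ⟨h1, h3⟩⟩ := exponentClass_eq_iff.mp h
      · rw [mul_one] at h1
        rw [← h1, one_mul] at h3
        exact .inl (Units.ext h3).symm
      · rw [mul_one] at h3
        have h4 : (1 : (ZMod p)ˣ) = a * b := by
          rw [Units.ext h3]
          exact Units.ext h1
        exact .inr (eq_inv_of_mul_eq_one_right h4.symm)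
    · rintro (rfl | rfl)
      · rfl
      · exact exponentClass_eq_iff.mpr ⟨a, .inr ⟨(Units.mul_inv a).symm, (mul_one _).symm⟩⟩
  have hfix : {a : (ZMod p)ˣ | a⁻¹ = a} = {1, -1} := by
    ext a
    rw [Set.mem_ofPred_eq, inv_eq_iff_mul_eq_one, ← pow_two, Set.mem_insert_iff,
      Set.mem_singleton_iff, Units.ext_iff, Units.ext_iff, Units.ext_iff]
    push_cast
    exact sq_eq_one_iff
  have hne : (1 : (ZMod p)ˣ) ≠ -1 := by
    intro h
    have h3 := congrArg Units.val h
    push_cast at h3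
    exact h2 (by linear_combination h3)
  rw [hfix, Set.ncard_pair hne, card_units_zmod] at hF
  have hfin : Finite (ExponentClass p) := Quotient.finite _
  have hu : (Set.univ : Set (ExponentClass p)) =
      Set.range F ∪ {exponentClass 0 0, exponentClass 0 1} := by
    refine (Set.eq_univ_of_forall fun x => ?_).symm
    obtain ⟨i, j, rfl⟩ := exponentClass_surjective x
    by_cases hi : i = 0
    · right
      by_cases hj : j = 0
      · left
        rw [hi, hj]
      · right
        exact exponentClass_eq_iff.mpr ⟨Units.mk0 j hj, .inl (by simp [hi])⟩
    · by_cases hj : j = 0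
      · exact .inr (.inr (exponentClass_eq_iff.mpr ⟨Units.mk0 i hi, .inr (by simp [hj])⟩))
      · exact .inl ⟨Units.mk0 j hj / Units.mk0 i hi,
          (exponentClass_eq_iff.mpr ⟨Units.mk0 i hi, .inl (by simp [mul_div_cancel₀, hi])⟩).symm⟩
  have hd : Disjoint (Set.range F) {exponentClass 0 0, exponentClass 0 1} := by
    rw [Set.disjoint_left]
    rintro _ ⟨k, rfl⟩ (h | h)
    · exact one_ne_zero (exponentClass_eq_zero_iff.mp h).1
    · obtain ⟨u, ⟨h1, h3⟩ | ⟨h1, h3⟩⟩ := exponentClass_eq_iff.mp h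
      · simp at h1
      · simp at h3
  have h01 : (exponentClass 0 0 : ExponentClass p) ≠ exponentClass 0 1 := fun h =>
    one_ne_zero (exponentClass_eq_zero_iff.mp h.symm).2
  rw [← Set.ncard_univ, hu, Set.ncard_union_eq hd, Set.ncard_pair h01, mul_add, hF]
  have := (Fact.out : p.Prime).one_lt
  omega

theorem two_mul_card_braceInvariant (hp : p ≠ 2) :
    2 * Nat.card (BraceInvariant p) = p ^ 2 + 4 * p + 9 := by
  have hfin : Finite (ExponentClass p) := Quotient.finite _
  have h1 := two_mul_card_exponentClass hp
  have h2 : 2 * Nat.card (Sym2 (ZMod p)) = (p + 1) * p := by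
    rw [Nat.card_eq_fintype_card, Sym2.card, ZMod.card, Nat.choose_two_right, Nat.add_sub_cancel]
    exact Nat.mul_div_cancel' (by
      rw [mul_comm]
      exact (Nat.even_mul_succ_self p).two_dvd)
  rw [Nat.card_sum, Nat.card_sum, Nat.card_sum, mul_add, mul_add, mul_add, h1, h2]
  simp
  ring

theorem card_exponents_eq (x : ExponentClass p) :
    {y : BraceInvariant p | y.exponents = x}.ncard = 1 +
      ({s : Sym2 (ZMod p) | Sym2.lift ⟨exponentClass, exponentClass_swap⟩ s = x}.ncard +
      ({b : Bool | (if b then exponentClass 0 0 else exponentClass 2 1) = x}.ncard +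
      {j : ZMod p | exponentClass (2 * j) j = x}.ncard)) := by
  have hfin : Finite (ExponentClass p) := Quotient.finite _
  rw [← Nat.card_coe_set_eq]
  have e := (Equiv.subtypeSum (p := fun y : BraceInvariant p => y.exponents = x)).trans
    ((Equiv.refl _).sumCongr (Equiv.subtypeSum.trans ((Equiv.refl _).sumCongr Equiv.subtypeSum)))
  refine (Nat.card_congr e).trans ?_
  rw [Nat.card_sum, Nat.card_sum, Nat.card_sum]
  congr 1
  exact Nat.card_unique (α := {y : ExponentClass p // y = x})

/-- The unordered pairs in a class form one orbit under scaling. -/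
theorem setOf_lift_exponentClass_eq (i j : ZMod p) :
    {s : Sym2 (ZMod p) | Sym2.lift ⟨exponentClass, exponentClass_swap⟩ s = exponentClass i j} =
      Set.range fun u : (ZMod p)ˣ => s((u : ZMod p) * i, (u : ZMod p) * j) := by
  ext s
  induction s using Sym2.ind with
  | _ a b =>
    rw [Set.mem_ofPred_eq, Sym2.lift_mk, Set.mem_range]
    refine exponentClass_eq_iff.trans (exists_congr fun u => ?_)
    rw [Sym2.eq_iff]
    constructor <;> rintro (⟨h1, h2⟩ | ⟨h1, h2⟩) <;> simp [h1, h2]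

/-- The sum of the pair is `u(i + j)`, which recovers `u`. -/
theorem ncard_range_sym2_of_ne {i j : ZMod p} (hij : i + j ≠ 0) :
    (Set.range fun u : (ZMod p)ˣ => s((u : ZMod p) * i, (u : ZMod p) * j)).ncard = p - 1 := by
  rw [← Set.image_univ, Set.ncard_image_of_injective, Set.ncard_univ, card_units_zmod]
  intro u v h
  refine Units.ext (mul_right_cancel₀ hij ?_)
  rcases Sym2.eq_iff.mp h with ⟨h1, h2⟩ | ⟨h1, h2⟩ <;> linear_combination h1 + h2

/-- The units `u` and `-u` give the same unordered pair, and `-u ≠ u` for odd `p`. -/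
theorem two_mul_ncard_range_sym2_neg (hp : p ≠ 2) :
    2 * (Set.range fun u : (ZMod p)ˣ => s((u : ZMod p) * 1, (u : ZMod p) * -1)).ncard = p - 1 := by
  have h2 := two_ne_zero_zmod hp
  have hfix : {u : (ZMod p)ˣ | -u = u} = ∅ := by
    refine Set.eq_empty_of_forall_notMem fun u hu => ?_
    have h3 := congrArg Units.val (hu : -u = u)
    push_cast at h3
    have h4 : 2 * (u : ZMod p) = 0 := by linear_combination -h3
    exact (mul_ne_zero h2 u.ne_zero) h4
  rw [two_mul_ncard_range _ (fun u => -u), card_units_zmod, hfix, Set.ncard_empty, add_zero]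
  · intro a b
    rw [Sym2.eq_iff, Units.ext_iff, Units.ext_iff]
    push_cast
    constructor
    · rintro (⟨h, -⟩ | ⟨h, -⟩)
      · exact .inl (by linear_combination -h)
      · exact .inr (by linear_combination h)
    · rintro (h | h) <;> simp [h]

theorem setOf_bool_eq_empty {x : ExponentClass p} (h0 : exponentClass 0 0 ≠ x)
    (h1 : exponentClass 2 1 ≠ x) :
    {b : Bool | (if b then exponentClass 0 0 else exponentClass 2 1) = x} = ∅ := by
  refine Set.eq_empty_of_forall_notMem ?_
  rintro (_ | _) hb
  · exact h1 hb
  · exact h0 hb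

theorem setOf_bool_eq_singleton {x : ExponentClass p} (h0 : exponentClass 0 0 ≠ x)
    (h1 : exponentClass 2 1 = x) :
    {b : Bool | (if b then exponentClass 0 0 else exponentClass 2 1) = x} = {false} := by
  ext b
  cases b
  · simp [h1]
  · simp [h0]

theorem setOf_exponentClass_two_mul_eq_empty {x : ExponentClass p} (h0 : exponentClass 0 0 ≠ x)
    (h1 : exponentClass 2 1 ≠ x) : {j : ZMod p | exponentClass (2 * j) j = x} = ∅ := by
  refine Set.eq_empty_of_forall_notMem fun j hj => ?_
  by_cases hj0 : j = 0
  · rw [Set.mem_ofPred_eq, hj0, mul_zero] at hj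
    exact h0 hj
  · rw [Set.mem_ofPred_eq, exponentClass_two_mul hj0] at hj
    exact h1 hj

theorem ncard_setOf_exponentClass_two_mul {x : ExponentClass p} (h0 : exponentClass 0 0 ≠ x)
    (h1 : exponentClass 2 1 = x) : {j : ZMod p | exponentClass (2 * j) j = x}.ncard = p - 1 := by
  have : {j : ZMod p | exponentClass (2 * j) j = x} = {0}ᶜ := by
    ext j
    rw [Set.mem_ofPred_eq, Set.mem_compl_singleton_iff]
    constructor
    · rintro h rfl
      rw [mul_zero] at h
      exact h0 h
    · intro hj
      rw [exponentClass_two_mul hj, h1]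
  rw [this, Set.ncard_compl, Nat.card_zmod, Set.ncard_singleton]

theorem card_exponents_zero :
    {y : BraceInvariant p | y.exponents = exponentClass 0 0}.ncard = 4 := by
  have h21 : (exponentClass 2 1 : ExponentClass p) ≠ exponentClass 0 0 := fun h =>
    one_ne_zero (exponentClass_eq_zero_iff.mp h).2
  have e1 : (Set.range fun u : (ZMod p)ˣ => s((u : ZMod p) * 0, (u : ZMod p) * 0)) = {s(0, 0)} := by
    simp only [mul_zero, Set.range_const]
  have e2 : {b : Bool | (if b then exponentClass 0 0 else exponentClass 2 1 : ExponentClass p) =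
      exponentClass 0 0} = {true} := by
    ext b
    cases b <;> simp [h21]
  have e3 : {j : ZMod p | exponentClass (2 * j) j = exponentClass 0 0} = {0} := by
    ext j
    rw [Set.mem_ofPred_eq, exponentClass_eq_zero_iff, Set.mem_singleton_iff]
    exact ⟨And.right, fun h => by simp [h]⟩
  rw [card_exponents_eq, setOf_lift_exponentClass_eq, e1, e2, e3]
  simp

/-- The count is `1 + (p - 1)`: nothing with `δ = 1` occurs. -/
theorem card_exponents_of_ne {i j : ZMod p} (h0 : i ≠ 0 ∨ j ≠ 0) (hij : i + j ≠ 0)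
    (h1 : (exponentClass 2 1 : ExponentClass p) ≠ exponentClass i j) :
    {y : BraceInvariant p | y.exponents = exponentClass i j}.ncard = p := by
  have h0' : exponentClass 0 0 ≠ exponentClass i j := fun h => by
    have := exponentClass_eq_zero_iff.mp h.symm
    tauto
  rw [card_exponents_eq, setOf_lift_exponentClass_eq, ncard_range_sym2_of_ne hij,
    setOf_bool_eq_empty h0' h1, setOf_exponentClass_two_mul_eq_empty h0' h1, Set.ncard_empty,
    Set.ncard_empty]
  have := (Fact.out : p.Prime).one_lt
  omega

/-- The case `δ = 1` adds `1` for `ε = 0` and `p - 1` for `ε = 1`. -/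
theorem card_exponents_of_eq {i j : ZMod p} (h0 : i ≠ 0 ∨ j ≠ 0) (hij : i + j ≠ 0)
    (h1 : (exponentClass 2 1 : ExponentClass p) = exponentClass i j) :
    {y : BraceInvariant p | y.exponents = exponentClass i j}.ncard = 2 * p := by
  have h0' : exponentClass 0 0 ≠ exponentClass i j := fun h => by
    have := exponentClass_eq_zero_iff.mp h.symm
    tauto
  rw [card_exponents_eq, setOf_lift_exponentClass_eq, ncard_range_sym2_of_ne hij,
    setOf_bool_eq_singleton h0' h1, ncard_setOf_exponentClass_two_mul h0' h1, Set.ncard_singleton]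
  have := (Fact.out : p.Prime).one_lt
  omega

theorem exponentClass_zero_ne_neg : (exponentClass 0 0 : ExponentClass p) ≠ exponentClass 1 (-1) :=
  fun h => one_ne_zero (exponentClass_eq_zero_iff.mp h.symm).1

theorem two_mul_card_exponents_neg (hp : p ≠ 2) (hp3 : p ≠ 3) :
    2 * {y : BraceInvariant p | y.exponents = exponentClass 1 (-1)}.ncard = p + 1 := by
  have h3 : ((3 : ℕ) : ZMod p) ≠ 0 := by
    rw [Ne, ZMod.natCast_eq_zero_iff, Nat.prime_dvd_prime_iff_eq Fact.out Nat.prime_three]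
    exact hp3
  push_cast at h3
  have h1 : (exponentClass 2 1 : ExponentClass p) ≠ exponentClass 1 (-1) := fun h => by
    obtain ⟨u, ⟨h1, h2⟩ | ⟨h1, h2⟩⟩ := exponentClass_eq_iff.mp h <;>
      exact h3 (by linear_combination h1 + h2)
  have h2 := two_mul_ncard_range_sym2_neg hp
  rw [card_exponents_eq, setOf_lift_exponentClass_eq,
    setOf_bool_eq_empty exponentClass_zero_ne_neg h1,
    setOf_exponentClass_two_mul_eq_empty exponentClass_zero_ne_neg h1, Set.ncard_empty,
    Set.ncard_empty]
  have := (Fact.out : p.Prime).one_lt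
  omega

/-- Modulo `3` one has `2 = -1`, so braces with `δ = 1` occur too: `1 + 1 + 1 + 2`. -/
theorem card_exponents_neg_three (hp3 : p = 3) :
    {y : BraceInvariant p | y.exponents = exponentClass 1 (-1)}.ncard = 5 := by
  have h3 : (3 : ZMod p) = 0 := by
    subst hp3
    rfl
  have h1 : (exponentClass 2 1 : ExponentClass p) = exponentClass 1 (-1) :=
    exponentClass_eq_iff.mpr ⟨1, .inr ⟨by push_cast; linear_combination h3, by simp⟩⟩
  have h2 := two_mul_ncard_range_sym2_neg (p := p) (by omega)
  rw [card_exponents_eq, setOf_lift_exponentClass_eq,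
    setOf_bool_eq_singleton exponentClass_zero_ne_neg h1,
    ncard_setOf_exponentClass_two_mul exponentClass_zero_ne_neg h1, Set.ncard_singleton]
  omega

end Counting

theorem exists_addChar {p q : ℕ} [Fact p.Prime] [Fact q.Prime] (l : (ZMod q)ˣ)
    (hl : orderOf l = p) : ∃ ψ : AddChar (ZMod p) (ZMod q), Function.Injective ψ ∧
      ∀ n : ℤ, ψ n = ((l ^ n : (ZMod q)ˣ) : ZMod q) := by
  have hl1 : (l : ZMod q) ^ p = 1 := by
    rw [← Units.val_pow_eq_pow_val, ← hl, pow_orderOf_eq_one, Units.val_one]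
  have hψ : ∀ n : ℤ, AddChar.zmodChar p hl1 n = ((l ^ n : (ZMod q)ˣ) : ZMod q) := by
    intro n
    rw [← zsmul_one, AddChar.map_zsmul_eq_zpow, ← Nat.cast_one, AddChar.zmodChar_apply', pow_one,
      Units.val_zpow_eq_zpow_val]
  refine ⟨AddChar.zmodChar p hl1, fun a b h => ?_, hψ⟩
  obtain ⟨m, rfl⟩ := ZMod.intCast_surjective a
  obtain ⟨n, rfl⟩ := ZMod.intCast_surjective b
  rw [hψ, hψ, Units.val_inj, zpow_eq_zpow_iff_modEq, hl] at h
  exact (ZMod.intCast_eq_intCast_iff _ _ _).mpr h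

theorem mainTheorem5 (p q : ℕ) [Fact p.Prime] [Fact q.Prime]
    (hpq : p < q) (hq : 5 ≤ q) (h1 : p ∣ q - 1) (h2 : ¬ p ∣ q + 1) (h3 : ¬ p ^ 2 ∣ q - 1)
    (l : (ZMod q)ˣ) (hl : orderOf l = p) :
    -- the total number
    ((bracesWithAdd (ZMod (p ^ 2 * q) × ZMod q)).ncard : ℚ) = ((p : ℚ) ^ 2 + 4 * p + 9) / 2 ∧
    -- multiplicative group `ℤ/(p²q) × ℤ/(q)`
    (bracesWithAddMul (ZMod (p ^ 2 * q) × ZMod q)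
      (Multiplicative (ZMod (p ^ 2 * q) × ZMod q))).ncard = 4 ∧
    -- `M = diag(1, l)`
    (bracesWithAddMul (ZMod (p ^ 2 * q) × ZMod q) (SemidirectM p q l hl 0 1)).ncard = p ∧
    -- `M = diag(l, l)`
    (bracesWithAddMul (ZMod (p ^ 2 * q) × ZMod q) (SemidirectM p q l hl 1 1)).ncard = p ∧
    -- `M = diag(l, l ^ k)`, `k` different from `1`, `-1`, `1 / 2` and its inverse `2`
    (∀ k : (ZMod p)ˣ, k ≠ 1 → k ≠ -1 → 2 * (k : ZMod p) ≠ 1 → (k : ZMod p) ≠ 2 →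
      (bracesWithAddMul (ZMod (p ^ 2 * q) × ZMod q)
        (SemidirectM p q l hl 1 ((k : ZMod p).val : ℤ))).ncard = p) ∧
    -- `M = diag(l, l⁻¹)` and `M = diag(l, l ^ ((p + 1) / 2))`, for `p ≠ 3`
    (p ≠ 3 →
      ((bracesWithAddMul (ZMod (p ^ 2 * q) × ZMod q)
        (SemidirectM p q l hl 1 (-1))).ncard : ℚ) = ((p : ℚ) + 1) / 2 ∧
      (bracesWithAddMul (ZMod (p ^ 2 * q) × ZMod q)
        (SemidirectM p q l hl 1 (((p + 1) / 2 : ℕ) : ℤ))).ncard = 2 * p) ∧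
    -- for `p = 3` these two matrices coincide
    (p = 3 →
      (bracesWithAddMul (ZMod (p ^ 2 * q) × ZMod q) (SemidirectM p q l hl 1 (-1))).ncard = 5) := by
  have hq2 : q ≠ 2 := by omega
  have hqodd : Odd q := (Fact.out : q.Prime).odd_of_ne_two hq2
  have hp : p ≠ 2 := by
    rintro rfl
    exact h2 hqodd.add_one.two_dvd
  have h20 := two_ne_zero_zmod hp
  obtain ⟨ψ, hinj, hψ⟩ := exists_addChar l hl
  have hrange := bracesWithAdd_eq_range h1 h2 h3 hp hq2 hpq l hl ψ hψ
  have hcls := BraceCode.toClass_eq_iff hpq.ne hinj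
  have hcount : ∀ (G : Type) [Group G] (i j : ZMod p),
      (∀ s : BraceParam p q, s.ψ = ψ → s.ε = 0 → s.δ = 0 → s.i = i → s.j = j →
        Nonempty (G ≃* s.Carrier)) →
      (bracesWithAddMul (ZMod (p ^ 2 * q) × ZMod q) G).ncard =
        {x : BraceInvariant p | x.exponents = exponentClass i j}.ncard := by
    intro G _ i j hG
    rw [bracesWithAddMul_eq_image hp hq2 hpq.ne ψ hinj hrange G i j hG,
      ncard_image_eq_of_eq_iff hcls, Set.image_preimage_eq _ BraceCode.invariant_surjective]
  have hM : ∀ i j : ℤ, (bracesWithAddMul (ZMod (p ^ 2 * q) × ZMod q)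
      (SemidirectM p q l hl i j)).ncard =
        {x : BraceInvariant p | x.exponents = exponentClass (i : ZMod p) (j : ZMod p)}.ncard :=
    fun i j => hcount _ i j fun s hs hε hδ hi hj =>
      BraceParam.nonempty_mulEquiv_semidirectM l hl i j s (by rwa [hs]) hε hδ hi hj
  refine ⟨?_, ?_, ?_, ?_, fun k hk1 hk2 hk3 hk4 => ?_, fun hp3 => ⟨?_, ?_⟩, fun hp3 => ?_⟩
  · rw [hrange, ← Set.image_univ, ncard_image_eq_of_eq_iff hcls, Set.image_univ,
      BraceCode.invariant_surjective.range_eq, Set.ncard_univ, eq_div_iff two_ne_zero, mul_comm]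
    exact_mod_cast two_mul_card_braceInvariant hp
  · rw [hcount _ 0 0 fun s _ hε hδ hi hj =>
      BraceParam.nonempty_mulEquiv_multiplicative hpq.ne s hε hδ hi hj, card_exponents_zero]
  · rw [hM, Int.cast_zero, Int.cast_one, card_exponents_of_ne (.inr one_ne_zero) (by simp)]
    intro h
    obtain ⟨u, ⟨h4, h5⟩ | ⟨h4, h5⟩⟩ := exponentClass_eq_iff.mp h
    · exact h20 (by simpa using h4)
    · exact absurd h5 (by simp)
  · rw [hM, Int.cast_one, card_exponents_of_ne (.inr one_ne_zero) (by rwa [one_add_one_eq_two])]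
    intro h
    obtain ⟨u, ⟨h4, h5⟩ | ⟨h4, h5⟩⟩ := exponentClass_eq_iff.mp h <;>
      exact one_ne_zero (α := ZMod p) (by linear_combination h4 - h5)
  · rw [hM, Int.cast_one, Int.cast_natCast, ZMod.natCast_zmod_val,
      card_exponents_of_ne (.inl one_ne_zero)]
    · intro h
      refine hk2 (Units.ext ?_)
      push_cast
      linear_combination h
    · intro h
      obtain ⟨u, ⟨h4, h5⟩ | ⟨h4, h5⟩⟩ := exponentClass_eq_iff.mp h
      -- The pairs `(2, 1)` and `(1, k)` are proportional up to order only for `k = 1/2` or `k = 2`.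
      · exact hk3 (by linear_combination (k : ZMod p) * h4 - h5)
      · exact hk4 (by linear_combination (k : ZMod p) * h5 - h4)
  · rw [hM, eq_div_iff two_ne_zero, mul_comm, Int.cast_one, Int.cast_neg, Int.cast_one]
    exact_mod_cast two_mul_card_exponents_neg hp hp3
  · have hhalf : 2 * (((p + 1) / 2 : ℕ) : ZMod p) = 1 := by
      have hodd : Odd p := (Fact.out : p.Prime).odd_of_ne_two hp
      have h4 : 2 * ((p + 1) / 2) = p + 1 := Nat.mul_div_cancel' hodd.add_one.two_dvd
      have h5 := congrArg (Nat.cast : ℕ → ZMod p) h4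
      push_cast at h5
      rwa [ZMod.natCast_self, zero_add] at h5
    have h30 : ((3 : ℕ) : ZMod p) ≠ 0 := by
      rw [Ne, ZMod.natCast_eq_zero_iff, Nat.prime_dvd_prime_iff_eq Fact.out Nat.prime_three]
      exact hp3
    push_cast at h30
    rw [hM, Int.cast_one, Int.cast_natCast, card_exponents_of_eq (.inl one_ne_zero)]
    · intro h
      -- The sum of the exponents is `1 + 1/2 = 3/2`, which is nonzero as `p ≠ 3`.
      exact h30 (by linear_combination 2 * h - hhalf)
    · exact exponentClass_eq_iff.mpr ⟨Units.mk0 2 h20, .inl ⟨by simp, hhalf.symm⟩⟩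
  · rw [hM, Int.cast_one, Int.cast_neg, Int.cast_one, card_exponents_neg_three hp3]
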